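/- Let $G,c>0$ be constants and let $\phi:\mathbb{R}^3\to[0,\infty)$ be smooth and compactly supported. For $a,\alpha\in[0,1]$ consider the generalized Poisson equation $$\theta^\alpha\,\Delta\theta=-4\pi\,\frac{G}{2c^2}\,\phi \quad\text{on } \mathbb{R}^3,\qquad \lim_{|x|\to\infty}\theta(x)=a, \tag{$*$}$$ where $\Delta$ is the Euclidean Laplacian, a solution is a function $\theta\in C^2(\mathbb{R}^3)$ with $\theta\ge 0$ that satisfies $(*)$ at every point, and $\theta^0=1$. (1) For every $a\in[0,1]$ (including $a=0$) and every $\alpha\in[0,1]$, $(*)$ has exactly one solution $\theta_{a,\alpha}$. It is smooth, and it is strictly positive on $\mathbb{R}^3$ if $a>0$ or $\phi\not\equiv0$. (2) The solution depends continuously on $(a,\alpha)$: if $(a_n,\alpha_n)\in[0,1]^2$ and $(a_n,\alpha_n)\to(a,\alpha)$, then for every compact $K\subset\mathbb{R}^3$ all derivatives, of every order $k\ge0$, of $\theta_{a_n,\alpha_n}$ converge uniformly on $K$ to the corresponding derivatives of $\theta_{a,\alpha}$. (3) For $0\le a\le b\le1$ and $\alpha\in[0,1]$, $0\le\theta_{b,\alpha}-\theta_{a,\alpha}\le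 b-a$ on $\mathbb{R}^3$. (4) For $a\in[0,1]$ and $0\le\alpha\le\beta\le1$, $a^\beta\theta_{a,\beta}\le a^\alpha\theta_{a,\alpha}$ on $\mathbb{R}^3$ (with $0^0=1$). -/

import Mathlib

open Filter Topology Set
open scoped ContDiff Laplacian

/-- Three-dimensional Euclidean space. -/
abbrev E3 : Type := EuclideanSpace ℝ (Fin 3)

/-- `θ` is a solution of the generalized Poisson equation
`θ ^ α Δθ = -4π (G / 2c²) φ`, `θ → a` at infinity, with matter distribution `ω = φ dvol`.
Solutions are classical (`C²`).  The function `θ` is a conformal factor, and `θ ^ α` has to make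
sense, so `θ` is taken nonnegative; for `α = 0` the factor `θ ^ α` is the constant `1`. -/
structure IsGenPoissonSolution (G c : ℝ) (φ : E3 → ℝ) (a α : ℝ) (θ : E3 → ℝ) : Prop where
  contDiff : ContDiff ℝ 2 θ
  nonneg : ∀ x, 0 ≤ θ x
  equation : ∀ x, θ x ^ α * (Δ θ) x = -4 * Real.pi * (G / (2 * c ^ 2)) * φ x
  limit : Tendsto θ (cocompact E3) (𝓝 a)

/-- Convergence of functions on `ℝ³` with all derivatives, uniformly on compact subsets. -/
def TendstoSmoothOnCompacts (u : ℕ → E3 → ℝ) (v : E3 → ℝ) : Prop :=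
  ∀ K : Set E3, IsCompact K → ∀ k : ℕ,
    TendstoUniformlyOn (fun n => iteratedFDeriv ℝ k (u n)) (iteratedFDeriv ℝ k v) atTop K

/-! Put κ = 4πG/(2c²). A solution is superharmonic, so at a zero of θ, which is a minimum, Δθ
vanishes and the equation forces φ = 0 there. One may therefore divide by θ^α and study Δθ = -κ φ
θ^(-α) (`IsPoissonSol`). The right side increases with θ, which is the favourable sign for the
maximum principle: applied to pθ - qτ - d (`IsPoissonSol.mul_le_mul_add`) it gives uniqueness, the
bounds in the boundary value and, with p and q powers of a, the monotonicity in the exponent.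
Positivity is the strong minimum principle.

For existence with φ ≢ 0 one solves θ = a + N(κ φ θ^(-α)), where N is the Newtonian potential.
Written for g = log θ, the right side defines a contraction with constant α in the sup norm, which
settles α < 1. For α = 1 one takes the limit of solutions with exponents increasing to 1. The
sequence is Cauchy by an explicit estimate in the exponent, which follows from comparing a^β τ with
a^α θ and M^α θ with M^β τ, M being a common upper bound. That estimate needs a boundary value away
from 0; raising it to max(a, δ) costs only O(δ).

The same estimates make the solution jointly continuous in (a, α, x). Since N gains one derivative
jointly with parameters (`JointC.conv_newtonKernel`), the integral equation bootstraps this to joint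
continuity of all derivatives, hence to locally uniform convergence. The facts about N come from
smoothing 1/|x| to (c⁻² + |x|²)^(-1/2), whose Laplacian is minus 4π times an approximate identity.
-/

/-! ### Partial derivatives and the Laplacian -/

/-- The partial derivative of `u` in the `i`-th coordinate direction. -/
noncomputable def pd (i : Fin 3) (u : E3 → ℝ) (x : E3) : ℝ :=
  fderiv ℝ u x (EuclideanSpace.single i 1)

lemma fderiv_eq_sum_pd (u : E3 → ℝ) (x : E3) :
    fderiv ℝ u x = ∑ i, pd i u x • (EuclideanSpace.proj i : E3 →L[ℝ] ℝ) := by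
  ext v
  have hv : v = ∑ i, v i • (EuclideanSpace.single i (1 : ℝ) : E3) := by
    have := (EuclideanSpace.basisFun (Fin 3) ℝ).sum_repr v
    simpa using this.symm
  conv_lhs => rw [hv]
  simp [map_sum, pd, mul_comm]

lemma ContDiff.pd {u : E3 → ℝ} {n : ℕ} (hu : ContDiff ℝ (n + 1) u) (i : Fin 3) :
    ContDiff ℝ n (pd i u) := by
  have h := hu.fderiv_right (m := n) le_rfl
  exact h.clm_apply contDiff_const

lemma laplacian_eq_sum_pd {u : E3 → ℝ} (hu : ContDiff ℝ 2 u) (x : E3) :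
    (Δ u) x = ∑ i, pd i (pd i u) x := by
  rw [congrFun (InnerProductSpace.laplacian_eq_iteratedFDeriv_orthonormalBasis u
    (EuclideanSpace.basisFun (Fin 3) ℝ)) x]
  refine Finset.sum_congr rfl fun i _ => ?_
  rw [iteratedFDeriv_two_apply]
  have hd : DifferentiableAt ℝ (fderiv ℝ u) x :=
    (hu.fderiv_right (m := 1) le_rfl).differentiable one_ne_zero x
  have : pd i u = fun y => fderiv ℝ u y (EuclideanSpace.single i 1) := rfl
  rw [this, pd, fderiv_clm_apply hd (differentiableAt_const _)]
  simp

/-! ### Smoothness in space, jointly continuous in parameters -/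

section JointSmoothness

variable {X : Type*} [TopologicalSpace X]

/-- A family `u` of functions is jointly `C^k` in the space variable: the partial derivatives of
order at most `k` exist and are continuous in the parameter and the point together. -/
def JointC : ℕ → (X → E3 → ℝ) → Prop
  | 0, u => Continuous fun q : X × E3 => u q.1 q.2
  | k + 1, u => (∀ p, Differentiable ℝ (u p)) ∧ (Continuous fun q : X × E3 => u q.1 q.2) ∧
      ∀ i, JointC k fun p => pd i (u p)

lemma JointC.continuous {k : ℕ} {u : X → E3 → ℝ} (h : JointC k u) :
    Continuous fun q : X × E3 => u q.1 q.2 := by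
  cases k with
  | zero => exact h
  | succ k => exact h.2.1

lemma JointC.pred {k : ℕ} {u : X → E3 → ℝ} (h : JointC (k + 1) u) : JointC k u := by
  induction k generalizing u with
  | zero => exact h.2.1
  | succ k ih => exact ⟨h.1, h.2.1, fun i => ih (h.2.2 i)⟩

lemma JointC.add {k : ℕ} {u v : X → E3 → ℝ} (hu : JointC k u) (hv : JointC k v) :
    JointC k fun p x => u p x + v p x := by
  induction k generalizing u v with
  | zero => exact Continuous.add hu hv
  | succ k ih =>
    refine ⟨fun p => (hu.1 p).add (hv.1 p), hu.2.1.add hv.2.1, fun i => ?_⟩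
    convert ih (hu.2.2 i) (hv.2.2 i) using 3 with p x
    simp only [pd]
    rw [fderiv_fun_add (hu.1 p x) (hv.1 p x)]; rfl

lemma JointC.mul {k : ℕ} {u v : X → E3 → ℝ} (hu : JointC k u) (hv : JointC k v) :
    JointC k fun p x => u p x * v p x := by
  induction k generalizing u v with
  | zero => exact Continuous.mul hu hv
  | succ k ih =>
    refine ⟨fun p => (hu.1 p).mul (hv.1 p), hu.2.1.mul hv.2.1, fun i => ?_⟩
    convert (ih hu.pred (hv.2.2 i)).add (ih hv.pred (hu.2.2 i)) using 3 with p x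
    simp only [pd]
    rw [fderiv_fun_mul (hu.1 p x) (hv.1 p x)]; rfl

lemma JointC.parameter {k : ℕ} {c : X → ℝ} (hc : Continuous c) :
    JointC k fun p (_ : E3) => c p := by
  induction k generalizing c with
  | zero => exact hc.comp continuous_fst
  | succ k ih =>
    refine ⟨fun p => differentiable_const _, hc.comp continuous_fst, fun i => ?_⟩
    convert ih (c := fun _ => 0) continuous_const using 3 with p x
    simp [pd]

lemma JointC.of_contDiff {k : ℕ} {f : E3 → ℝ} (hf : ContDiff ℝ k f) :
    JointC k fun (_ : X) => f := by
  induction k generalizing f with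
  | zero => exact hf.continuous.comp continuous_snd
  | succ k ih =>
    exact ⟨fun p => hf.differentiable (by simp), hf.continuous.comp continuous_snd,
      fun i => ih (ContDiff.pd (by exact_mod_cast hf) i)⟩

lemma JointC.exp {k : ℕ} {u : X → E3 → ℝ} (hu : JointC k u) :
    JointC k fun p x => Real.exp (u p x) := by
  induction k generalizing u with
  | zero => exact Real.continuous_exp.comp hu
  | succ k ih =>
    refine ⟨fun p => (hu.1 p).exp, Real.continuous_exp.comp hu.2.1, fun i => ?_⟩
    convert (ih hu.pred).mul (hu.2.2 i) using 3 with p x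
    simp only [pd]
    rw [fderiv_exp (hu.1 p x)]; rfl

lemma JointC.inv {k : ℕ} {u : X → E3 → ℝ} (hu : JointC k u) (h0 : ∀ p x, u p x ≠ 0) :
    JointC k fun p x => (u p x)⁻¹ := by
  induction k generalizing u with
  | zero => exact Continuous.inv₀ hu fun q => h0 _ _
  | succ k ih =>
    refine ⟨fun p x => (hu.1 p x).inv (h0 p x), hu.2.1.inv₀ fun q => h0 _ _, fun i => ?_⟩
    have h1 := ih hu.pred h0
    convert (JointC.parameter (c := fun _ => (-1 : ℝ)) continuous_const).mul
      ((h1.mul h1).mul (hu.2.2 i)) using 3 with p x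
    simp only [pd]
    have e : HasFDerivAt (fun y => (u p y)⁻¹) (-(u p x ^ 2)⁻¹ • fderiv ℝ (u p) x) x :=
      (hasDerivAt_inv (h0 p x)).comp_hasFDerivAt x (hu.1 p x).hasFDerivAt
    rw [e.fderiv]
    simp [pow_two]

lemma JointC.log {k : ℕ} {u : X → E3 → ℝ} (hu : JointC k u) (h0 : ∀ p x, u p x ≠ 0) :
    JointC k fun p x => Real.log (u p x) := by
  induction k generalizing u with
  | zero => exact Continuous.log hu fun q => h0 _ _
  | succ k ih =>
    refine ⟨fun p x => (hu.1 p x).log (h0 p x), hu.2.1.log fun q => h0 _ _, fun i => ?_⟩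
    convert (hu.pred.inv h0).mul (hu.2.2 i) using 3 with p x
    simp only [pd]
    rw [((hu.1 p x).hasFDerivAt.log (h0 p x)).fderiv]; rfl

lemma JointC.contDiff {k : ℕ} {u : X → E3 → ℝ} (hu : JointC k u) (p : X) :
    ContDiff ℝ k (u p) := by
  induction k generalizing u with
  | zero =>
    rw [Nat.cast_zero, contDiff_zero]
    exact hu.continuous.comp (Continuous.prodMk_right p)
  | succ k ih =>
    rw [Nat.cast_succ, contDiff_succ_iff_fderiv]
    refine ⟨hu.1 p, by simp, ?_⟩
    rw [funext (fderiv_eq_sum_pd (u p))]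
    exact ContDiff.sum fun i _ => (ih (hu.2.2 i)).smul contDiff_const

lemma JointC.continuous_iteratedFDeriv {k : ℕ} {u : X → E3 → ℝ} (hu : JointC k u) :
    Continuous fun q : X × E3 => iteratedFDeriv ℝ k (u q.1) q.2 := by
  induction k generalizing u with
  | zero =>
    simp only [iteratedFDeriv_zero_eq_comp]
    exact (continuousMultilinearCurryFin0 ℝ E3 ℝ).symm.continuous.comp hu.continuous
  | succ k ih =>
    simp only [iteratedFDeriv_succ_eq_comp_right, Function.comp_apply]
    refine (continuousMultilinearCurryRightEquiv' ℝ k E3 ℝ).symm.continuous.comp ?_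
    let L : Fin 3 → ℝ →L[ℝ] (E3 →L[ℝ] ℝ) := fun i =>
      (ContinuousLinearMap.id ℝ ℝ).smulRight (EuclideanSpace.proj i : E3 →L[ℝ] ℝ)
    have key : ∀ q : X × E3, iteratedFDeriv ℝ k (fun y => fderiv ℝ (u q.1) y) q.2 =
        ∑ i, (L i).compContinuousMultilinearMap (iteratedFDeriv ℝ k (pd i (u q.1)) q.2) := by
      intro q
      have hc : ∀ i, ContDiff ℝ k (pd i (u q.1)) := fun i => (hu.2.2 i).contDiff q.1
      have e : (fun y => fderiv ℝ (u q.1) y) = fun y => ∑ i, (L i ∘ pd i (u q.1)) y := by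
        ext1 y
        rw [fderiv_eq_sum_pd]; rfl
      rw [e, iteratedFDeriv_fun_sum_apply fun i _ => ((L i).contDiff.comp (hc i)).contDiffAt]
      refine Finset.sum_congr rfl fun i _ => ?_
      exact (L i).iteratedFDeriv_comp_left (hc i).contDiffAt le_rfl
    simp only [key]
    refine continuous_finsetSum _ fun i _ => ?_
    exact (ContinuousLinearMap.compContinuousMultilinearMapL ℝ (fun _ : Fin k => E3) ℝ
      (E3 →L[ℝ] ℝ) (L i)).continuous.comp (ih (hu.2.2 i))

/-- A jointly continuous map curries to a continuous map into the space of continuous functions with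
the compact-open topology, where convergence is uniform convergence on compact sets. -/
lemma tendstoSmoothOnCompacts_of_jointC {u : X → E3 → ℝ} (hu : ∀ k, JointC k u) {p : ℕ → X}
    {q : X} (hp : Tendsto p atTop (𝓝 q)) :
    TendstoSmoothOnCompacts (fun n => u (p n)) (u q) := by
  intro K hK k
  let F : C(X, C(E3, E3 [×k]→L[ℝ] ℝ)) := ContinuousMap.curry
    ⟨fun q : X × E3 => iteratedFDeriv ℝ k (u q.1) q.2, (hu k).continuous_iteratedFDeriv⟩
  exact ContinuousMap.tendsto_iff_forall_isCompact_tendstoUniformlyOn.1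
    ((F.continuous.tendsto q).comp hp) K hK

end JointSmoothness

/-! ### Maximum principles -/

lemma hasDerivAt_comp_add_smul {w : E3 → ℝ} (hw : Differentiable ℝ w) (x : E3) (i : Fin 3)
    (t : ℝ) : HasDerivAt (fun s : ℝ => w (x + s • EuclideanSpace.single i (1 : ℝ)))
      (pd i w (x + t • EuclideanSpace.single i (1 : ℝ))) t := by
  have h1 : HasDerivAt (fun s : ℝ => x + s • EuclideanSpace.single i (1 : ℝ))
      (EuclideanSpace.single i (1 : ℝ)) t := by
    simpa using ((hasDerivAt_id t).smul_const (EuclideanSpace.single i (1 : ℝ))).const_add x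
  exact (hw _).hasFDerivAt.comp_hasDerivAt t h1

/-- Were the second derivative positive, the second derivative test would make the point a local
minimum along the line as well. The function would then be constant there, with second derivative
zero. -/
lemma IsLocalMax.pd_pd_nonpos {w : E3 → ℝ} (hw : ContDiff ℝ 2 w) {x : E3} (hx : IsLocalMax w x)
    (i : Fin 3) : pd i (pd i w) x ≤ 0 := by
  by_contra! hpos
  set g : ℝ → ℝ := fun s => w (x + s • EuclideanSpace.single i (1 : ℝ)) with hg
  have hd1 : deriv g = fun t => pd i w (x + t • EuclideanSpace.single i (1 : ℝ)) :=
    funext fun t => (hasDerivAt_comp_add_smul (hw.differentiable two_ne_zero) x i t).deriv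
  have hw' : ContDiff ℝ 1 (pd i w) := by
    simpa using ContDiff.pd (n := 1) (u := w) (by exact_mod_cast hw) i
  have hd2 : deriv (deriv g) 0 = pd i (pd i w) x := by
    rw [hd1, (hasDerivAt_comp_add_smul (hw'.differentiable one_ne_zero) x i 0).deriv]
    simp
  have hcont : ContinuousAt (fun s : ℝ => x + s • EuclideanSpace.single i (1 : ℝ)) 0 := by
    fun_prop
  have hmax : IsLocalMax g 0 := by
    have h0 : x + (0 : ℝ) • EuclideanSpace.single i (1 : ℝ) = x := by simp
    have := hcont.tendsto
    rw [h0] at this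
    filter_upwards [this.eventually hx] with s hs
    simpa [hg] using hs
  have hgc : ContinuousAt g 0 :=
    (hasDerivAt_comp_add_smul (hw.differentiable two_ne_zero) x i 0).continuousAt
  have hmin : IsLocalMin g 0 :=
    isLocalMin_of_deriv_deriv_pos (by rw [hd2]; exact hpos) hmax.deriv_eq_zero hgc
  have hc : g =ᶠ[𝓝 0] fun _ => g 0 := by
    filter_upwards [hmax, hmin] with s h1 h2 using le_antisymm h1 h2
  have h2 : deriv (deriv g) 0 = 0 := by
    rw [hc.deriv.deriv_eq]
    simp
  linarith

lemma IsLocalMax.laplacian_nonpos {w : E3 → ℝ} (hw : ContDiff ℝ 2 w) {x : E3}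
    (hx : IsLocalMax w x) : (Δ w) x ≤ 0 := by
  rw [laplacian_eq_sum_pd hw]
  exact Finset.sum_nonpos fun i _ => hx.pd_pd_nonpos hw i

lemma IsLocalMin.laplacian_nonneg {w : E3 → ℝ} (hw : ContDiff ℝ 2 w) {x : E3}
    (hx : IsLocalMin w x) : 0 ≤ (Δ w) x := by
  have h := IsLocalMax.laplacian_nonpos hw.neg hx.neg
  have e : (fun y => -w y) = -w := rfl
  rw [e, InnerProductSpace.laplacian_neg] at h
  simpa using h

lemma fderiv_norm_sq_sub (x₀ x : E3) (v : E3) :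
    fderiv ℝ (fun y : E3 => ‖y - x₀‖ ^ 2) x v = 2 * inner ℝ (x - x₀) v := by
  have h : HasFDerivAt (fun y : E3 => ‖y - x₀‖ ^ 2) _ x :=
    ((hasFDerivAt_id x).sub_const x₀).norm_sq
  rw [h.fderiv]
  simp [inner_sub_left]

lemma pd_norm_sq_sub (x₀ : E3) (i : Fin 3) :
    pd i (fun y : E3 => ‖y - x₀‖ ^ 2) = fun x => 2 * (x i - x₀ i) := by
  ext x
  rw [pd, fderiv_norm_sq_sub]
  simp [EuclideanSpace.inner_single_right]

lemma hasFDerivAt_coord_sub (x₀ x : E3) (i : Fin 3) :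
    HasFDerivAt (fun y : E3 => y i - x₀ i) (EuclideanSpace.proj i : E3 →L[ℝ] ℝ) x :=
  ((EuclideanSpace.proj i : E3 →L[ℝ] ℝ).hasFDerivAt (x := x)).sub_const (x₀ i)

lemma contDiff_norm_sq_sub (x₀ : E3) {n : WithTop ℕ∞} :
    ContDiff ℝ n fun y : E3 => ‖y - x₀‖ ^ 2 :=
  (contDiff_norm_sq ℝ).comp (contDiff_id.sub contDiff_const)

lemma laplacian_norm_sq (x : E3) : (Δ fun y : E3 => ‖y - 0‖ ^ 2) x = 6 := by
  rw [laplacian_eq_sum_pd (contDiff_norm_sq_sub 0)]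
  have : ∀ i, pd i (pd i fun y : E3 => ‖y - 0‖ ^ 2) x = 2 := by
    intro i
    rw [pd_norm_sq_sub, pd, ((hasFDerivAt_coord_sub 0 x i).const_mul 2).fderiv]
    simp
  simp only [this]; norm_num

/-- The weak maximum principle on the whole space. -/
lemma le_zero_of_laplacian_nonneg {w : E3 → ℝ} (hw : ContDiff ℝ 2 w) {l : ℝ}
    (hlim : Tendsto w (cocompact E3) (𝓝 l)) (hl : l ≤ 0) (hΔ : ∀ x, 0 < w x → 0 ≤ (Δ w) x)
    (x : E3) : w x ≤ 0 := by
  by_contra! hx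
  set δ := w x / 2 with hδ
  have hδ0 : 0 < δ := by positivity
  have hev : ∀ᶠ y in cocompact E3, w y < δ := hlim.eventually_lt_const (by linarith)
  obtain ⟨K₀, hK₀, hK₀'⟩ := mem_cocompact.1 hev
  have hsub : {y | δ ≤ w y} ⊆ K₀ := by
    intro y hy
    by_contra h
    exact not_lt.2 (show δ ≤ w y from hy) (by simpa using hK₀' h)
  have hK : IsCompact {y | δ ≤ w y} :=
    hK₀.of_isClosed_subset (isClosed_le continuous_const hw.continuous) hsub
  obtain ⟨R, hR⟩ := hK.isBounded.exists_norm_le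
  have hR0 : 0 < R ^ 2 + 1 := by positivity
  -- The perturbation ε‖y‖² stays below δ on the compact set where w ≥ δ. As w x = 2δ, the maximum
  -- of W over that set lies where w > δ, so it is a local maximum, although ΔW ≥ 6ε > 0 there.
  set ε := δ / (R ^ 2 + 1) with hε
  have hε0 : 0 < ε := by positivity
  have hεR : ε * R ^ 2 < δ := by
    rw [hε, div_mul_eq_mul_div, div_lt_iff₀ hR0]; nlinarith
  set W : E3 → ℝ := w + ε • fun y : E3 => ‖y - 0‖ ^ 2 with hW
  have hq : ContDiff ℝ 2 fun y : E3 => ‖y - 0‖ ^ 2 := contDiff_norm_sq_sub 0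
  have hεq : ContDiff ℝ 2 (ε • fun y : E3 => ‖y - 0‖ ^ 2) := hq.const_smul ε
  have hWc : ContDiff ℝ 2 W := hw.add hεq
  have hxK : x ∈ {y | δ ≤ w y} := by change δ ≤ w x; linarith
  obtain ⟨z, hzK, hz⟩ := hK.exists_isMaxOn ⟨x, hxK⟩ hWc.continuous.continuousOn
  have hzx : W x ≤ W z := hz hxK
  have hzR : ‖z‖ ^ 2 ≤ R ^ 2 := by
    have := hR z hzK
    gcongr
  have hwz : δ < w z := by
    have h1 : W x = w x + ε * ‖x‖ ^ 2 := by simp [hW]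
    have h2 : W z = w z + ε * ‖z‖ ^ 2 := by simp [hW]
    have h3 : ε * ‖z‖ ^ 2 ≤ ε * R ^ 2 := by gcongr
    have h4 : 0 ≤ ε * ‖x‖ ^ 2 := by positivity
    linarith
  have hloc : IsLocalMax W z := by
    have : {y | δ < w y} ∈ 𝓝 z := (isOpen_lt continuous_const hw.continuous).mem_nhds hwz
    filter_upwards [this] with y hy
    exact hz (le_of_lt hy)
  have h1 := hloc.laplacian_nonpos hWc
  rw [hW, ContDiffAt.laplacian_add hw.contDiffAt hεq.contDiffAt,
    InnerProductSpace.laplacian_smul _ hq.contDiffAt, laplacian_norm_sq] at h1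
  have h2 := hΔ z (hδ0.trans hwz)
  simp only [smul_eq_mul] at h1
  linarith

/-- The barrier `1 / (s + |x - x₀|²)`. -/
noncomputable def barrier (s : ℝ) (x₀ x : E3) : ℝ := (s + ‖x - x₀‖ ^ 2)⁻¹

lemma contDiff_barrier {s : ℝ} (hs : 0 < s) (x₀ : E3) : ContDiff ℝ 2 (barrier s x₀) :=
  (contDiff_const.add (contDiff_norm_sq_sub x₀)).inv fun x => by positivity

lemma pd_barrier {s : ℝ} (hs : 0 < s) (x₀ : E3) (i : Fin 3) :
    pd i (barrier s x₀) = fun x => -2 * (x i - x₀ i) * ((s + ‖x - x₀‖ ^ 2)⁻¹) ^ 2 := by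
  ext x
  have hd : HasFDerivAt (fun y : E3 => s + ‖y - x₀‖ ^ 2) _ x :=
    (((contDiff_norm_sq_sub x₀ (n := 1)).differentiable one_ne_zero) x).hasFDerivAt.const_add s
  have hne : s + ‖x - x₀‖ ^ 2 ≠ 0 := by positivity
  have e : HasFDerivAt (barrier s x₀) _ x := (hasDerivAt_inv hne).comp_hasFDerivAt x hd
  have h := congrFun (pd_norm_sq_sub x₀ i) x
  rw [pd] at h
  rw [pd, e.fderiv]
  simp only [smul_apply, h, smul_eq_mul]
  field_simp

/-- Subharmonic exactly where ‖x - x₀‖² ≥ 3s. Unlike 1/|x - x₀| the barrier is smooth at the centre,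
so the maximum principle on the whole space applies to it and no exterior domain is needed. -/
lemma laplacian_barrier {s : ℝ} (hs : 0 < s) (x₀ x : E3) :
    (Δ (barrier s x₀)) x =
      2 * (‖x - x₀‖ ^ 2 - 3 * s) * ((s + ‖x - x₀‖ ^ 2)⁻¹) ^ 3 := by
  rw [laplacian_eq_sum_pd (contDiff_barrier hs x₀)]
  set ρ := s + ‖x - x₀‖ ^ 2 with hρ
  have hρ0 : 0 < ρ := by positivity
  have key : ∀ i, pd i (pd i (barrier s x₀)) x =
      -2 * ρ⁻¹ ^ 2 + 8 * (x i - x₀ i) ^ 2 * ρ⁻¹ ^ 3 := by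
    intro i
    have hb := (((contDiff_barrier hs x₀).differentiable two_ne_zero) x).hasFDerivAt
    have hbi := congrFun (pd_barrier hs x₀ i) x
    have h1 : HasFDerivAt (fun y : E3 => -2 * (y i - x₀ i) * (barrier s x₀ y) ^ 2) _ x :=
      ((hasFDerivAt_coord_sub x₀ x i).const_mul (-2)).mul (hb.pow 2)
    rw [pd_barrier hs, pd]
    have e : (fun y : E3 => -2 * (y i - x₀ i) * ((s + ‖y - x₀‖ ^ 2)⁻¹) ^ 2) =
      fun y : E3 => -2 * (y i - x₀ i) * (barrier s x₀ y) ^ 2 := rfl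
    rw [pd] at hbi
    rw [e, h1.fderiv]
    simp [hbi, barrier, ← hρ]
    field_simp
    ring
  simp only [key, Fin.sum_univ_three]
  have hn : ‖x - x₀‖ ^ 2 = (x 0 - x₀ 0) ^ 2 + (x 1 - x₀ 1) ^ 2 + (x 2 - x₀ 2) ^ 2 := by
    rw [EuclideanSpace.norm_sq_eq]; simp [Fin.sum_univ_three]
  have hs' : s = ρ - ‖x - x₀‖ ^ 2 := by simp [hρ]
  rw [hs', hn]
  field_simp
  ring

lemma tendsto_barrier (s : ℝ) (x₀ : E3) : Tendsto (barrier s x₀) (cocompact E3) (𝓝 0) := by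
  refine tendsto_inv_atTop_zero.comp (tendsto_atTop_add_const_left _ _ ?_)
  refine (tendsto_pow_atTop two_ne_zero).comp ?_
  exact tendsto_norm_cocompact_atTop.comp (Homeomorph.subRight x₀).isClosedEmbedding.tendsto_cocompact

/-- The strong minimum principle for nonnegative superharmonic functions with a limit at
infinity. -/
lemma pos_of_laplacian_nonpos {u : E3 → ℝ} (hu : ContDiff ℝ 2 u) (h0 : ∀ x, 0 ≤ u x) {l : ℝ}
    (hlim : Tendsto u (cocompact E3) (𝓝 l)) (hΔ : ∀ x, (Δ u) x ≤ 0) {x₀ : E3} (hx₀ : 0 < u x₀)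
    (x : E3) : 0 < u x := by
  obtain ⟨r, hr, hball⟩ := Metric.eventually_nhds_iff.1
    (hu.continuous.continuousAt.eventually_const_lt (half_lt_self hx₀))
  set m := u x₀ / 2
  have hm : 0 < m := by positivity
  -- With this s the barrier is subharmonic outside the ball of radius r. Inside, m * s * barrier ≤
  -- m < u, so the difference is not positive there.
  set s := r ^ 2 / 3 with hs
  have hs0 : 0 < s := by positivity
  have hl : 0 ≤ l := ge_of_tendsto' hlim h0
  have hb := contDiff_barrier hs0 x₀
  have hb' : ContDiff ℝ 2 ((m * s) • barrier s x₀) := hb.const_smul (m * s)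
  have hle := le_zero_of_laplacian_nonneg (w := (m * s) • barrier s x₀ - u)
    (hb'.sub hu)
    (((tendsto_barrier s x₀).const_smul (m * s)).sub hlim) (by simpa using hl) (fun y hy => by
      have hyr : r ≤ dist y x₀ := by
        by_contra! h
        have h1 := hball h
        have h2 : (m * s) * barrier s x₀ y ≤ m := by
          rw [barrier, ← div_eq_mul_inv, div_le_iff₀ (by positivity)]
          nlinarith [sq_nonneg ‖y - x₀‖, mul_nonneg hm.le (sq_nonneg ‖y - x₀‖)]
        simp only [Pi.sub_apply, Pi.smul_apply, smul_eq_mul] at hy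
        linarith
      rw [ContDiffAt.laplacian_sub hb'.contDiffAt hu.contDiffAt,
        InnerProductSpace.laplacian_smul _ hb.contDiffAt, laplacian_barrier hs0]
      have h3 : 0 ≤ ‖y - x₀‖ ^ 2 - 3 * s := by
        rw [dist_eq_norm] at hyr
        have : r ^ 2 ≤ ‖y - x₀‖ ^ 2 := by gcongr
        rw [hs]; linarith
      have h4 : 0 ≤ (m * s) • (2 * (‖y - x₀‖ ^ 2 - 3 * s) * (s + ‖y - x₀‖ ^ 2)⁻¹ ^ 3) := by
        rw [smul_eq_mul]; positivity
      linarith [hΔ y]) x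
  have hpos : 0 < (m * s) * barrier s x₀ x := by
    rw [barrier]; positivity
  simp only [Pi.sub_apply, Pi.smul_apply, smul_eq_mul] at hle
  linarith

/-! ### Convolution with compactly supported functions -/

section Convolution

open MeasureTheory

/-- Convolution of real functions on `ℝ³`. -/
noncomputable def conv (Q f : E3 → ℝ) (x : E3) : ℝ := ∫ t, Q t * f (x - t)

lemma conv_eq_convolution (Q f : E3 → ℝ) :
    conv Q f = MeasureTheory.convolution Q f (ContinuousLinearMap.mul ℝ ℝ) volume := rfl

lemma integrable_conv {Q f : E3 → ℝ} (hQ : LocallyIntegrable Q) (hf : Continuous f)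
    (hfc : HasCompactSupport f) (x : E3) : Integrable fun t => Q t * f (x - t) :=
  hfc.convolutionExists_right (ContinuousLinearMap.mul ℝ ℝ) hQ hf x

lemma hasFDerivAt_conv {Q f : E3 → ℝ} (hQ : LocallyIntegrable Q) (hf : ContDiff ℝ 1 f)
    (hfc : HasCompactSupport f) (x : E3) : DifferentiableAt ℝ (conv Q f) x ∧
      ∀ i, pd i (conv Q f) x = conv Q (pd i f) x := by
  have h := hfc.hasFDerivAt_convolution_right (ContinuousLinearMap.mul ℝ ℝ) hQ hf x
  refine ⟨h.differentiableAt, fun i => ?_⟩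
  rw [pd, conv_eq_convolution, h.fderiv, MeasureTheory.convolution_precompR_apply _ hQ
    (hfc.fderiv ℝ) (hf.continuous_fderiv one_ne_zero)]
  rfl

lemma continuous_conv_param {X : Type*} [TopologicalSpace X] {Q : E3 → ℝ}
    (hQ : LocallyIntegrable Q) {f : X → E3 → ℝ} {K : Set E3} (hK : IsCompact K)
    (hfK : ∀ p, ∀ x ∉ K, f p x = 0) (hf : Continuous fun q : X × E3 => f q.1 q.2) :
    Continuous fun q : X × E3 => conv Q (f q.1) q.2 := by
  have h := MeasureTheory.continuousOn_convolution_right_with_param (μ := volume)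
    (ContinuousLinearMap.mul ℝ ℝ)
    (s := (univ : Set X)) hK (fun p x _ hx => hfK p x hx) hQ (g := f) (by
      rw [univ_prod_univ, continuousOn_univ]; exact hf)
  rwa [univ_prod_univ, continuousOn_univ] at h

lemma pd_comp_sub {f : E3 → ℝ} (hf : Differentiable ℝ f) (x t : E3) (i : Fin 3) :
    pd i (fun s => f (x - s)) t = -pd i f (x - t) := by
  have h : HasFDerivAt (fun s : E3 => x - s) (-(ContinuousLinearMap.id ℝ E3)) t :=
    (hasFDerivAt_id t).const_sub x
  have h2 : HasFDerivAt (fun s => f (x - s)) _ t := (hf (x - t)).hasFDerivAt.comp t h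
  rw [pd, h2.fderiv, pd]
  simp

lemma HasCompactSupport.pd {f : E3 → ℝ} (hf : HasCompactSupport f) (i : Fin 3) :
    HasCompactSupport (pd i f) :=
  hf.fderiv_apply ℝ (EuclideanSpace.single i 1)

/-- Integration by parts; its sign cancels the one from differentiating f (x - t) in t. The kernel
has to be C¹, so singular kernels are reached only as limits of regularized ones. -/
lemma conv_pd_right {Q f : E3 → ℝ} (hQ : ContDiff ℝ 1 Q) (hf : ContDiff ℝ 1 f)
    (hfc : HasCompactSupport f) (i : Fin 3) (x : E3) :
    conv Q (pd i f) x = conv (pd i Q) f x := by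
  have hpf : Continuous (pd i f) := (ContDiff.pd (n := 0) (by simpa using hf) i).continuous
  have hpQ : Continuous (pd i Q) := (ContDiff.pd (n := 0) (by simpa using hQ) i).continuous
  have e : ∀ t, fderiv ℝ (fun s => f (x - s)) t (EuclideanSpace.single i 1) =
      -pd i f (x - t) := fun t => pd_comp_sub (hf.differentiable one_ne_zero) x t i
  have h := integral_mul_fderiv_eq_neg_fderiv_mul_of_integrable (μ := (volume : Measure E3))
    (f := Q) (g := fun t => f (x - t)) (v := EuclideanSpace.single i 1)
    (integrable_conv hpQ.locallyIntegrable hf.continuous hfc x)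
    (by
      simp only [e, mul_neg]
      exact (integrable_conv hQ.continuous.locallyIntegrable hpf (hfc.pd i) x).neg)
    (integrable_conv hQ.continuous.locallyIntegrable hf.continuous hfc x)
    (fun t _ => hQ.differentiable one_ne_zero t)
    (fun t _ => ((hf.comp (contDiff_const.sub contDiff_id)).differentiable one_ne_zero) t)
  simp only [e, mul_neg, integral_neg, neg_inj] at h
  exact h

lemma tendsto_conv {ι : Type*} {l : Filter ι} [l.IsCountablyGenerated] {Q : ι → E3 → ℝ}
    {Q₀ D f : E3 → ℝ} (hD : LocallyIntegrable D)
    (hQ : ∀ n, AEStronglyMeasurable (Q n) volume) (hQD : ∀ n, ∀ᵐ t, |Q n t| ≤ D t)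
    (hlim : ∀ᵐ t, Tendsto (fun n => Q n t) l (𝓝 (Q₀ t))) (hf : Continuous f)
    (hfc : HasCompactSupport f) (x : E3) :
    Tendsto (fun n => conv (Q n) f x) l (𝓝 (conv Q₀ f x)) := by
  refine tendsto_integral_filter_of_dominated_convergence (fun t => D t * |f (x - t)|)
    (Eventually.of_forall fun n => (hQ n).mul
      (hf.comp (continuous_const.sub continuous_id)).aestronglyMeasurable)
    (Eventually.of_forall fun n => ?_)
    (integrable_conv hD hf.abs hfc.norm x) ?_
  · filter_upwards [hQD n] with t ht
    rw [Real.norm_eq_abs, abs_mul]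
    exact mul_le_mul_of_nonneg_right ht (abs_nonneg _)
  · filter_upwards [hlim] with t ht using ht.mul_const _

/-- For ‖x‖ ≤ M only the t with ‖t‖ ≤ M + R contribute, so the error is at most δ n times the
integral of |Q| over that ball. -/
lemma tendstoUniformlyOn_conv {Q : E3 → ℝ} (hQ : LocallyIntegrable Q) {f : ℕ → E3 → ℝ}
    {f₀ : E3 → ℝ} (hf : ∀ n, Continuous (f n)) (hf₀ : Continuous f₀) {R : ℝ}
    (hfR : ∀ n, ∀ x ∉ Metric.closedBall 0 R, f n x = 0)
    (hf₀R : ∀ x ∉ Metric.closedBall 0 R, f₀ x = 0) {δ : ℕ → ℝ}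
    (hδ : Tendsto δ atTop (𝓝 0)) (hδf : ∀ n x, |f n x - f₀ x| ≤ δ n) (M : ℝ) :
    TendstoUniformlyOn (fun n => conv Q (f n)) (conv Q f₀) atTop (Metric.closedBall 0 M) := by
  have hc : ∀ {g : E3 → ℝ}, (∀ x ∉ Metric.closedBall 0 R, g x = 0) → HasCompactSupport g :=
    fun h => HasCompactSupport.intro (isCompact_closedBall 0 R) h
  set B := Metric.closedBall (0 : E3) (M + R) with hB
  have hQB : IntegrableOn (fun t => |Q t|) B :=
    (hQ.integrableOn_isCompact (isCompact_closedBall 0 _)).norm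
  set I := ∫ t in B, |Q t| with hI
  have hbound : ∀ n, ∀ x ∈ Metric.closedBall (0 : E3) M,
      |conv Q (f n) x - conv Q f₀ x| ≤ δ n * I := by
    intro n x hx
    rw [conv, conv, ← integral_sub (integrable_conv hQ (hf n) (hc (hfR n)) x)
      (integrable_conv hQ hf₀ (hc hf₀R) x), hI, ← integral_const_mul,
      ← integral_indicator Metric.isClosed_closedBall.measurableSet, ← Real.norm_eq_abs]
    refine norm_integral_le_of_norm_le ?_ (Eventually.of_forall fun t => ?_)
    · rw [integrable_indicator_iff Metric.isClosed_closedBall.measurableSet]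
      exact hQB.const_mul (δ n)
    · by_cases ht : t ∈ B
      · rw [indicator_of_mem ht, ← mul_sub, norm_mul, Real.norm_eq_abs, Real.norm_eq_abs,
          mul_comm]
        exact mul_le_mul_of_nonneg_right (hδf n _) (abs_nonneg _)
      · have hxt : x - t ∉ Metric.closedBall 0 R := by
          intro h
          apply ht
          rw [mem_closedBall_zero_iff] at *
          calc ‖t‖ = ‖x - (x - t)‖ := by simp
            _ ≤ ‖x‖ + ‖x - t‖ := norm_sub_le _ _
            _ ≤ M + R := add_le_add hx h
        rw [indicator_of_notMem ht, hfR n _ hxt, hf₀R _ hxt]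
        simp
  rw [Metric.tendstoUniformlyOn_iff]
  intro ε hε
  have h0 : Tendsto (fun n => δ n * I) atTop (𝓝 0) := by simpa using hδ.mul_const I
  filter_upwards [h0.eventually_lt_const hε] with n hn x hx
  rw [dist_comm, Real.dist_eq]
  exact (hbound n x hx).trans_lt hn

end Convolution

/-! ### The Newtonian potential -/

section NewtonPotential

open MeasureTheory

/-- The Newtonian kernel `1 / (4π|x|)`. -/
noncomputable def newtonKernel (x : E3) : ℝ := (4 * Real.pi)⁻¹ * ‖x‖⁻¹

/-- The partial derivatives of the Newtonian kernel. -/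
noncomputable def newtonGrad (i : Fin 3) (x : E3) : ℝ := -(4 * Real.pi)⁻¹ * (x i * ‖x‖⁻¹ ^ 3)

lemma coord_abs_le (x : E3) (i : Fin 3) : |x i| ≤ ‖x‖ := by
  simpa using PiLp.norm_apply_le x i

lemma coord_mul_inv_le (x : E3) (i : Fin 3) : |x i| * ‖x‖⁻¹ ^ 3 ≤ ‖x‖⁻¹ ^ 2 := by
  rcases eq_or_ne x 0 with rfl | hx
  · simp
  have h : 0 < ‖x‖ := norm_pos_iff.2 hx
  calc |x i| * ‖x‖⁻¹ ^ 3 ≤ ‖x‖ * ‖x‖⁻¹ ^ 3 := by gcongr; exact coord_abs_le x i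
    _ = ‖x‖⁻¹ ^ 2 := by field_simp

lemma locallyIntegrable_norm_inv_pow {k : ℕ} (hk : k < 3) :
    LocallyIntegrable fun x : E3 => (4 * Real.pi)⁻¹ * ‖x‖⁻¹ ^ k := by
  refine locallyIntegrable_of_norm_le_rpow (C := (4 * Real.pi)⁻¹) (α := k) (by simp)
    (by simpa using hk) (Eventually.of_forall fun x => ?_)
    (Measurable.aestronglyMeasurable (by fun_prop))
  rw [Real.rpow_neg (norm_nonneg _), Real.rpow_natCast, Real.norm_of_nonneg (by positivity),
    inv_pow]

lemma locallyIntegrable_newtonKernel : LocallyIntegrable newtonKernel := by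
  have h := locallyIntegrable_norm_inv_pow (k := 1) (by norm_num)
  simp only [pow_one] at h
  exact h

lemma locallyIntegrable_newtonGrad (i : Fin 3) : LocallyIntegrable (newtonGrad i) := by
  refine (locallyIntegrable_norm_inv_pow (k := 2) (by norm_num)).mono
    (Measurable.aestronglyMeasurable (by unfold newtonGrad; fun_prop))
    (Eventually.of_forall fun x => ?_)
  rw [newtonGrad, norm_mul, norm_mul, norm_neg, norm_mul]
  refine mul_le_mul_of_nonneg_left ?_ (norm_nonneg _)
  simpa using coord_mul_inv_le x i

/-- The reciprocal `(c⁻² + |x|²)^(-1/2)` of the regularized distance to the origin. -/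
noncomputable def regInv (c : ℝ) (x : E3) : ℝ := (√(c⁻¹ ^ 2 + ‖x‖ ^ 2))⁻¹

variable {c : ℝ}

lemma regInv_arg_pos (hc : 0 < c) (x : E3) : 0 < c⁻¹ ^ 2 + ‖x‖ ^ 2 := by positivity

lemma regInv_pos (hc : 0 < c) (x : E3) : 0 < regInv c x :=
  inv_pos.2 (Real.sqrt_pos.2 (regInv_arg_pos hc x))

lemma regInv_sq (hc : 0 < c) (x : E3) : (regInv c x) ^ 2 * (c⁻¹ ^ 2 + ‖x‖ ^ 2) = 1 := by
  have h := regInv_arg_pos hc x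
  rw [regInv, inv_pow, Real.sq_sqrt h.le, inv_mul_cancel₀ h.ne']

lemma regInv_le (c : ℝ) {x : E3} (hx : x ≠ 0) : regInv c x ≤ ‖x‖⁻¹ := by
  have hx' : 0 < ‖x‖ := norm_pos_iff.2 hx
  refine inv_anti₀ hx' (Real.le_sqrt_of_sq_le ?_)
  nlinarith [sq_nonneg c⁻¹]

lemma contDiff_regInv (hc : 0 < c) {n : WithTop ℕ∞} : ContDiff ℝ n (regInv c) :=
  ((contDiff_const.add (contDiff_norm_sq ℝ)).sqrt fun x => (regInv_arg_pos hc x).ne').inv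
    fun x => (Real.sqrt_pos.2 (regInv_arg_pos hc x)).ne'

lemma pd_regInv (hc : 0 < c) (i : Fin 3) :
    pd i (regInv c) = fun x => -(x i * regInv c x ^ 3) := by
  ext x
  have harg := regInv_arg_pos hc x
  have hn : HasFDerivAt (fun y : E3 => c⁻¹ ^ 2 + ‖y - 0‖ ^ 2) _ x :=
    (((contDiff_norm_sq_sub 0 (n := 1)).differentiable one_ne_zero) x).hasFDerivAt.const_add _
  have hg : HasDerivAt (fun s : ℝ => (√s)⁻¹) (-(1 / (2 * √(c⁻¹ ^ 2 + ‖x - 0‖ ^ 2))) /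
      (√(c⁻¹ ^ 2 + ‖x - 0‖ ^ 2)) ^ 2) (c⁻¹ ^ 2 + ‖x - 0‖ ^ 2) := by
    rw [sub_zero]
    exact (Real.hasDerivAt_sqrt harg.ne').fun_inv (Real.sqrt_pos.2 harg).ne'
  have h : HasFDerivAt ((fun s : ℝ => (√s)⁻¹) ∘ fun y : E3 => c⁻¹ ^ 2 + ‖y - 0‖ ^ 2) _ x :=
    hg.comp_hasFDerivAt x hn
  have e : regInv c = (fun s : ℝ => (√s)⁻¹) ∘ fun y : E3 => c⁻¹ ^ 2 + ‖y - 0‖ ^ 2 := by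
    ext y; simp [regInv]
  have hp := congrFun (pd_norm_sq_sub 0 i) x
  rw [pd] at hp
  rw [pd, e, h.fderiv]
  simp only [smul_apply, hp, smul_eq_mul]
  have hs := Real.sqrt_pos.2 harg
  simp only [sub_zero, Function.comp_apply] at hs ⊢
  generalize √(c⁻¹ ^ 2 + ‖x‖ ^ 2) = r at hs ⊢
  field_simp
  simp

lemma pd_pd_regInv (hc : 0 < c) (i : Fin 3) (x : E3) :
    pd i (pd i (regInv c)) x = 3 * x i ^ 2 * regInv c x ^ 5 - regInv c x ^ 3 := by
  have hr := ((contDiff_regInv hc (n := 1)).differentiable one_ne_zero x).hasFDerivAt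
  have hri := congrFun (pd_regInv hc i) x
  have hx : HasFDerivAt (fun y : E3 => y i) (EuclideanSpace.proj i : E3 →L[ℝ] ℝ) x :=
    (EuclideanSpace.proj i : E3 →L[ℝ] ℝ).hasFDerivAt
  have h : HasFDerivAt (fun y : E3 => -(y i * regInv c y ^ 3)) _ x := (hx.mul (hr.pow 3)).neg
  rw [pd] at hri
  rw [pd_regInv hc, pd, h.fderiv]
  simp [hri]
  ring

lemma sum_pd_pd_regInv (hc : 0 < c) (x : E3) :
    ∑ i, pd i (pd i (regInv c)) x = -(3 * c⁻¹ ^ 2 * regInv c x ^ 5) := by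
  simp only [pd_pd_regInv hc, Fin.sum_univ_three]
  have hn : ‖x‖ ^ 2 = x 0 ^ 2 + x 1 ^ 2 + x 2 ^ 2 := by
    rw [EuclideanSpace.norm_sq_eq]; simp [Fin.sum_univ_three]
  have h := regInv_sq hc x
  rw [hn] at h
  linear_combination 3 * regInv c x ^ 3 * h

lemma tendsto_regInv {x : E3} (hx : x ≠ 0) :
    Tendsto (fun c => regInv c x) atTop (𝓝 ‖x‖⁻¹) := by
  have hx' : 0 < ‖x‖ := norm_pos_iff.2 hx
  have h1 : Tendsto (fun c : ℝ => √(c⁻¹ ^ 2 + ‖x‖ ^ 2)) atTop (𝓝 ‖x‖) := by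
    have h2 : Tendsto (fun c : ℝ => c⁻¹ ^ 2 + ‖x‖ ^ 2) atTop (𝓝 (0 ^ 2 + ‖x‖ ^ 2)) :=
      (tendsto_inv_atTop_zero.pow 2).add_const _
    have h3 := h2.sqrt
    simpa [Real.sqrt_sq hx'.le] using h3
  exact h1.inv₀ hx'.ne'

/-- The regularized Newtonian kernel. -/
noncomputable def regKernel (c : ℝ) (x : E3) : ℝ := (4 * Real.pi)⁻¹ * regInv c x

lemma contDiff_regKernel (hc : 0 < c) {n : WithTop ℕ∞} : ContDiff ℝ n (regKernel c) :=
  contDiff_const.mul (contDiff_regInv hc)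

lemma pd_const_mul {u : E3 → ℝ} (hu : Differentiable ℝ u) (a : ℝ) (i : Fin 3) :
    pd i (fun x => a * u x) = fun x => a * pd i u x := by
  ext x
  rw [pd, fderiv_const_mul (hu x)]; rfl

lemma pd_regKernel (hc : 0 < c) (i : Fin 3) :
    pd i (regKernel c) = fun x => (4 * Real.pi)⁻¹ * pd i (regInv c) x :=
  pd_const_mul ((contDiff_regInv hc (n := 1)).differentiable one_ne_zero) _ i

/-- The right side is -c³ρ(cx) for the fixed profile ρ at c = 1, so it is the negative of an
approximate identity as c tends to infinity. -/
lemma sum_pd_pd_regKernel (hc : 0 < c) (x : E3) :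
    ∑ i, pd i (pd i (regKernel c)) x = -((4 * Real.pi)⁻¹ * (3 * c⁻¹ ^ 2 * regInv c x ^ 5)) := by
  have h : ∀ i, pd i (pd i (regKernel c)) x =
      (4 * Real.pi)⁻¹ * pd i (pd i (regInv c)) x := by
    intro i
    rw [pd_regKernel hc, pd_const_mul]
    exact (ContDiff.pd (n := 1) (contDiff_regInv hc) i).differentiable (by simp)
  simp only [h]
  rw [← Finset.mul_sum, sum_pd_pd_regInv hc, mul_neg]

lemma ae_ne_zero : ∀ᵐ t : E3, t ≠ 0 := by
  simp [ae_iff]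

lemma newtonKernel_nonneg (x : E3) : 0 ≤ newtonKernel x := by
  unfold newtonKernel; positivity

lemma tendsto_conv_regKernel {f : E3 → ℝ} (hf : Continuous f) (hfc : HasCompactSupport f)
    (x : E3) : Tendsto (fun n : ℕ => conv (regKernel (n + 1)) f x) atTop
      (𝓝 (conv newtonKernel f x)) := by
  have hpos : ∀ n : ℕ, (0 : ℝ) < n + 1 := fun n => by positivity
  refine tendsto_conv locallyIntegrable_newtonKernel
    (fun n => (contDiff_regKernel (hpos n) (n := 0)).continuous.aestronglyMeasurable)
    (fun n => ?_) ?_ hf hfc x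
  · filter_upwards [ae_ne_zero] with t ht
    rw [regKernel, newtonKernel, abs_of_nonneg (mul_nonneg (by positivity)
      (regInv_pos (hpos n) t).le)]
    exact mul_le_mul_of_nonneg_left (regInv_le _ ht) (by positivity)
  · filter_upwards [ae_ne_zero] with t ht
    exact ((tendsto_regInv ht).comp (tendsto_atTop_add_const_right _ _
      tendsto_natCast_atTop_atTop)).const_mul _

lemma tendsto_conv_pd_regKernel {f : E3 → ℝ} (hf : Continuous f) (hfc : HasCompactSupport f)
    (i : Fin 3) (x : E3) : Tendsto (fun n : ℕ => conv (pd i (regKernel (n + 1))) f x) atTop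
      (𝓝 (conv (newtonGrad i) f x)) := by
  have hpos : ∀ n : ℕ, (0 : ℝ) < n + 1 := fun n => by positivity
  refine tendsto_conv (locallyIntegrable_norm_inv_pow (k := 2) (by norm_num))
    (fun n => (ContDiff.pd (n := 0) (contDiff_regKernel (hpos n)) i).continuous.aestronglyMeasurable)
    (fun n => ?_) ?_ hf hfc x
  · filter_upwards [ae_ne_zero] with t ht
    have h1 := (regInv_pos (hpos n) t).le
    have h2 : |t i| * regInv (n + 1) t ^ 3 ≤ |t i| * ‖t‖⁻¹ ^ 3 := by
      gcongr
      exact regInv_le _ ht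
    rw [pd_regKernel (hpos n), pd_regInv (hpos n), abs_mul, abs_neg, abs_mul,
      abs_of_nonneg (show (0 : ℝ) ≤ (4 * Real.pi)⁻¹ by positivity), abs_of_nonneg (pow_nonneg h1 3)]
    exact mul_le_mul_of_nonneg_left (h2.trans (coord_mul_inv_le t i)) (by positivity)
  · filter_upwards [ae_ne_zero] with t ht
    have h := ((tendsto_regInv ht).comp (tendsto_atTop_add_const_right _ (1 : ℝ)
      tendsto_natCast_atTop_atTop))
    have h' := (((h.pow 3).const_mul (t i)).neg).const_mul (4 * Real.pi)⁻¹
    rw [newtonGrad, neg_mul, ← mul_neg]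
    refine h'.congr fun n => ?_
    rw [pd_regKernel (hpos n), pd_regInv (hpos n)]
    rfl

/-- True for the regularized kernels by parts. Both sides pass to the limit by dominated
convergence, with majorants that are multiples of 1/|x| and 1/|x|², locally integrable in dimension
three. -/
lemma conv_newtonKernel_pd {f : E3 → ℝ} (hf : ContDiff ℝ 1 f) (hfc : HasCompactSupport f)
    (i : Fin 3) (x : E3) : conv newtonKernel (pd i f) x = conv (newtonGrad i) f x := by
  have hpf : Continuous (pd i f) := (ContDiff.pd (n := 0) (by simpa using hf) i).continuous
  refine tendsto_nhds_unique (tendsto_conv_regKernel hpf (hfc.pd i) x) ?_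
  refine (tendsto_conv_pd_regKernel hf.continuous hfc i x).congr fun n => ?_
  rw [conv_pd_right (contDiff_regKernel (by positivity)) hf hfc]

/-- The Newtonian potential of a continuous compactly supported function is differentiable. -/
lemma hasFDerivAt_conv_newtonKernel {f : E3 → ℝ} (hf : Continuous f) (hfc : HasCompactSupport f)
    (x : E3) : HasFDerivAt (conv newtonKernel f)
      (∑ i, conv (newtonGrad i) f x • (EuclideanSpace.proj i : E3 →L[ℝ] ℝ)) x := by
  obtain ⟨R₀, hR₀⟩ := hfc.isCompact.isBounded.subset_closedBall (0 : E3)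
  set R := max R₀ 1
  have hR : 0 < R := lt_max_of_lt_right one_pos
  have hsub : tsupport f ⊆ Metric.closedBall 0 R :=
    hR₀.trans (Metric.closedBall_subset_closedBall (le_max_left _ _))
  -- Smooth uniform approximations of f need not have compact support. The cutoff restores it
  -- without increasing the error, since χ = 1 wherever f is nonzero.
  let χ : ContDiffBump (0 : E3) := ⟨R, R + 1, hR, by linarith⟩
  have hu : UniformContinuous f := hfc.uniformContinuous_of_continuous hf
  choose G hG hGf using fun n : ℕ =>
    hu.exists_contDiff_dist_le (ε := 1 / ((n : ℝ) + 1)) (by positivity)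
  set g : ℕ → E3 → ℝ := fun n y => χ y * G n y with hg
  have hgC : ∀ n, ContDiff ℝ 1 (g n) := fun n => χ.contDiff.mul ((hG n).of_le (by simp))
  have hχ0 : ∀ y ∉ Metric.closedBall (0 : E3) (R + 1), χ y = 0 := fun y hy => by
    have : y ∉ Function.support χ := by
      rw [χ.support_eq]
      exact fun h => hy (Metric.ball_subset_closedBall h)
    simpa using this
  have hgR : ∀ n, ∀ y ∉ Metric.closedBall (0 : E3) (R + 1), g n y = 0 := fun n y hy => by
    simp [hg, hχ0 y hy]
  have hf0 : ∀ y ∉ Metric.closedBall (0 : E3) R, f y = 0 := fun y hy =>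
    image_eq_zero_of_notMem_tsupport fun h => hy (hsub h)
  have hfR : ∀ y ∉ Metric.closedBall (0 : E3) (R + 1), f y = 0 := fun y hy =>
    hf0 y fun h => hy (Metric.closedBall_subset_closedBall (by linarith) h)
  have hgc : ∀ n, HasCompactSupport (g n) := fun n =>
    HasCompactSupport.intro (isCompact_closedBall 0 (R + 1)) (hgR n)
  have hδ : ∀ n y, |g n y - f y| ≤ 1 / ((n : ℝ) + 1) := by
    intro n y
    have e : g n y - f y = χ y * (G n y - f y) := by
      by_cases hy : y ∈ Metric.closedBall (0 : E3) R
      · simp [hg, χ.one_of_mem_closedBall hy]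
      · simp [hg, hf0 y hy]
    rw [e, abs_mul, abs_of_nonneg χ.nonneg]
    have := hGf n y
    rw [Real.dist_eq] at this
    calc χ y * |G n y - f y| ≤ 1 * |G n y - f y| := by gcongr; exact χ.le_one
      _ ≤ _ := by rw [one_mul]; exact this.le
  have hδ0 : Tendsto (fun n : ℕ => 1 / ((n : ℝ) + 1)) atTop (𝓝 0) :=
    tendsto_one_div_add_atTop_nhds_zero_nat
  have hunif : ∀ {Q : E3 → ℝ}, LocallyIntegrable Q → ∀ M,
      TendstoUniformlyOn (fun n => conv Q (g n)) (conv Q f) atTop (Metric.closedBall 0 M) :=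
    fun hQ M => tendstoUniformlyOn_conv hQ (fun n => (hgC n).continuous) hf hgR hfR hδ0 hδ M
  set s := Metric.ball (0 : E3) (‖x‖ + 1)
  have hs : s ⊆ Metric.closedBall 0 (‖x‖ + 1) := Metric.ball_subset_closedBall
  let L : Fin 3 → ℝ →L[ℝ] (E3 →L[ℝ] ℝ) := fun i =>
    (ContinuousLinearMap.id ℝ ℝ).smulRight (EuclideanSpace.proj i : E3 →L[ℝ] ℝ)
  have hL : ∀ i, TendstoUniformlyOn (fun n y => L i (conv (newtonGrad i) (g n) y))
      (fun y => L i (conv (newtonGrad i) f y)) atTop s := fun i =>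
    (L i).uniformContinuous.comp_tendstoUniformlyOn
      ((hunif (locallyIntegrable_newtonGrad i) (‖x‖ + 1)).mono hs)
  have key := hasFDerivAt_of_tendstoUniformlyOn (𝕜 := ℝ) (x := x) (s := s) (l := atTop)
    (f := fun n => conv newtonKernel (g n)) (g := conv newtonKernel f) Metric.isOpen_ball
    (((hL 0).add (hL 1)).add (hL 2)) (fun n y _ => by
      have h := hasFDerivAt_conv locallyIntegrable_newtonKernel (hgC n) (hgc n) y
      have h' := h.1.hasFDerivAt
      rw [fderiv_eq_sum_pd, Fin.sum_univ_three] at h'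
      simp only [h.2, conv_newtonKernel_pd (hgC n) (hgc n)] at h'
      exact h') (fun y hy => (hunif locallyIntegrable_newtonKernel _).tendsto_at (hs hy))
    (by simp [s])
  rw [Fin.sum_univ_three]
  exact key

lemma pd_conv_newtonKernel {f : E3 → ℝ} (hf : Continuous f) (hfc : HasCompactSupport f)
    (i : Fin 3) : pd i (conv newtonKernel f) = conv (newtonGrad i) f := by
  ext x
  rw [pd, (hasFDerivAt_conv_newtonKernel hf hfc x).fderiv]
  simp

/-- Forming the Newtonian potential gains one derivative, jointly with parameters. -/
lemma JointC.conv_newtonKernel {X : Type*} [TopologicalSpace X] {f : X → E3 → ℝ} {K : Set E3}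
    (hK : IsCompact K) {k : ℕ} (hfK : ∀ p, ∀ x ∉ K, f p x = 0) (hf : JointC k f) :
    JointC (k + 1) fun p => conv newtonKernel (f p) := by
  induction k generalizing f with
  -- A source that is only continuous forces the derivative onto the kernel. In the inductive step
  -- it falls on the source instead.
  | zero =>
    have hc : ∀ p, HasCompactSupport (f p) := fun p => HasCompactSupport.intro hK (hfK p)
    have hcont : ∀ p, Continuous (f p) := fun p =>
      hf.continuous.comp (Continuous.prodMk_right p)
    refine ⟨fun p x => (hasFDerivAt_conv_newtonKernel (hcont p) (hc p) x).differentiableAt,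
      continuous_conv_param locallyIntegrable_newtonKernel hK hfK hf.continuous, fun i => ?_⟩
    simp only [pd_conv_newtonKernel (hcont _) (hc _)]
    exact continuous_conv_param (locallyIntegrable_newtonGrad i) hK hfK hf.continuous
  | succ k ih =>
    have hc : ∀ p, HasCompactSupport (f p) := fun p => HasCompactSupport.intro hK (hfK p)
    have hcont : ∀ p, ContDiff ℝ 1 (f p) := fun p => (hf.contDiff p).of_le (by simp)
    refine ⟨fun p x => (hasFDerivAt_conv_newtonKernel (hcont p).continuous (hc p)
      x).differentiableAt,
      continuous_conv_param locallyIntegrable_newtonKernel hK hfK hf.continuous, fun i => ?_⟩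
    have e : (fun p => pd i (conv newtonKernel (f p))) =
        fun p => conv newtonKernel (pd i (f p)) := by
      ext p x
      exact (hasFDerivAt_conv locallyIntegrable_newtonKernel (hcont p) (hc p) x).2 i
    rw [e]
    refine ih (fun p x hx => ?_) (hf.2.2 i)
    have : f p =ᶠ[𝓝 x] fun _ => 0 := by
      filter_upwards [hK.isClosed.isOpen_compl.mem_nhds hx] with y hy using hfK p y hy
    rw [pd, this.fderiv_eq]
    simp

lemma finrank_E3 : Module.finrank ℝ E3 = 3 := by simp

lemma regInv_scale (hc : 0 < c) (x : E3) : regInv c x = c * regInv 1 (c • x) := by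
  have h : c⁻¹ ^ 2 + ‖x‖ ^ 2 = (c⁻¹) ^ 2 * ((1 : ℝ)⁻¹ ^ 2 + ‖c • x‖ ^ 2) := by
    rw [norm_smul, Real.norm_of_nonneg hc.le]
    field_simp
  rw [regInv, regInv, h, Real.sqrt_mul (by positivity), Real.sqrt_sq (by positivity), mul_inv,
    inv_inv]

/-- The integrand has the primitive (y / √(1 + y²))³, which rises from 0 to 1. -/
lemma integral_three_mul_sq_mul_rpow :
    ∫ y in Ioi (0 : ℝ), 3 * y ^ 2 * (√(1 + y ^ 2))⁻¹ ^ 5 = 1 := by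
  have hpos : ∀ y : ℝ, 0 < 1 + y ^ 2 := fun y => by positivity
  have hr : ∀ y : ℝ, HasDerivAt (fun y : ℝ => (√(1 + y ^ 2))⁻¹)
      (-(y * (√(1 + y ^ 2))⁻¹ ^ 3)) y := by
    intro y
    have h1 : HasDerivAt (fun y : ℝ => 1 + y ^ 2) (2 * y) y := by
      simpa using (hasDerivAt_pow 2 y).const_add 1
    have h2 := (h1.sqrt (hpos y).ne').fun_inv (Real.sqrt_pos.2 (hpos y)).ne'
    refine h2.congr_deriv ?_
    have := Real.sqrt_pos.2 (hpos y)
    generalize √(1 + y ^ 2) = r at this ⊢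
    field_simp
  have hsq : ∀ y : ℝ, (√(1 + y ^ 2))⁻¹ ^ 2 * (1 + y ^ 2) = 1 := fun y => by
    rw [inv_pow, Real.sq_sqrt (hpos y).le, inv_mul_cancel₀ (hpos y).ne']
  have hd : ∀ y : ℝ, HasDerivAt (fun y : ℝ => (y * (√(1 + y ^ 2))⁻¹) ^ 3)
      (3 * y ^ 2 * (√(1 + y ^ 2))⁻¹ ^ 5) y := by
    intro y
    have h := ((hasDerivAt_id y).fun_mul (hr y)).fun_pow 3
    refine h.congr_deriv ?_
    simp only [id]
    push_cast
    linear_combination -3 * y ^ 2 * (√(1 + y ^ 2))⁻¹ ^ 3 * hsq y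
  have hlim : Tendsto (fun y : ℝ => (y * (√(1 + y ^ 2))⁻¹) ^ 3) atTop (𝓝 1) := by
    have h1 : Tendsto (fun y : ℝ => √(1 - (1 + y ^ 2)⁻¹)) atTop (𝓝 (√(1 - 0))) :=
      ((tendsto_inv_atTop_zero.comp (tendsto_atTop_add_const_left _ _
        (tendsto_pow_atTop two_ne_zero))).const_sub 1).sqrt
    have h2 : Tendsto (fun y : ℝ => y * (√(1 + y ^ 2))⁻¹) atTop (𝓝 1) := by
      rw [sub_zero, Real.sqrt_one] at h1
      refine h1.congr' ?_
      filter_upwards [eventually_ge_atTop 0] with y hy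
      have e : 1 - (1 + y ^ 2)⁻¹ = y ^ 2 / (1 + y ^ 2) := by
        have := (hpos y).ne'
        field_simp
        ring
      rw [e, Real.sqrt_div (sq_nonneg y), Real.sqrt_sq hy, div_eq_mul_inv]
    simpa using h2.pow 3
  have h := integral_Ioi_of_hasDerivAt_of_nonneg (a := 0) (l := 1)
    (hd 0).continuousAt.continuousWithinAt (fun y _ => hd y) (fun y _ => by positivity) hlim
  rw [h]
  simp

/-- In polar coordinates the factor is the dimension 3 times the volume 4π/3 of the unit ball, which
cancels (4π)⁻¹. -/
lemma integral_regInv_pow : ∫ x : E3, (4 * Real.pi)⁻¹ * (3 * regInv 1 x ^ 5) = 1 := by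
  have h := integral_fun_norm_addHaar (volume : Measure E3)
    (fun y : ℝ => (4 * Real.pi)⁻¹ * (3 * (√(1 + y ^ 2))⁻¹ ^ 5))
  have e : (fun x : E3 => (4 * Real.pi)⁻¹ * (3 * regInv 1 x ^ 5)) =
      fun x : E3 => (4 * Real.pi)⁻¹ * (3 * (√(1 + ‖x‖ ^ 2))⁻¹ ^ 5) := by
    ext x; simp [regInv]
  have e2 : ∀ y : ℝ, y ^ (3 - 1) • ((4 * Real.pi)⁻¹ * (3 * (√(1 + y ^ 2))⁻¹ ^ 5)) =
      (4 * Real.pi)⁻¹ * (3 * y ^ 2 * (√(1 + y ^ 2))⁻¹ ^ 5) := fun y => by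
    simp only [smul_eq_mul]; ring
  rw [e, h, finrank_E3]
  simp only [e2]
  rw [integral_const_mul, integral_three_mul_sq_mul_rpow, Measure.real,
    EuclideanSpace.volume_ball_fin_three]
  have hpi := Real.pi_pos
  rw [ENNReal.toReal_mul, ENNReal.toReal_ofReal (by positivity)]
  simp
  field_simp

lemma tendsto_conv_sum_pd_pd_regKernel {f : E3 → ℝ} (hf : Continuous f)
    (hfc : HasCompactSupport f) (x : E3) :
    Tendsto (fun n : ℕ => ∑ i, conv (pd i (pd i (regKernel (n + 1)))) f x) atTop (𝓝 (-f x)) := by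
  have hpos : ∀ n : ℕ, (0 : ℝ) < n + 1 := fun n => by positivity
  have hg : Continuous fun t => f (x - t) := hf.comp (continuous_const.sub continuous_id)
  have hgi : Integrable fun t => f (x - t) :=
    (hf.integrable_of_hasCompactSupport hfc).comp_sub_left x
  have hdecay : Tendsto (fun x : E3 => ‖x‖ ^ Module.finrank ℝ E3 *
      ((4 * Real.pi)⁻¹ * (3 * regInv 1 x ^ 5))) (Bornology.cobounded E3) (𝓝 0) := by
    have h1 : Tendsto (fun x : E3 => (4 * Real.pi)⁻¹ * (3 * ‖x‖⁻¹ ^ 2)) (Bornology.cobounded E3)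
        (𝓝 0) := by
      have := (((tendsto_inv_atTop_zero.comp
        (tendsto_norm_cobounded_atTop (E := E3))).pow 2).const_mul 3).const_mul (4 * Real.pi)⁻¹
      simpa using this
    refine squeeze_zero (fun y => ?_) (fun y => ?_) h1
    · have := (regInv_pos one_pos y).le
      positivity
    · rcases eq_or_ne y 0 with rfl | hy
      · simp
      have hy' : 0 < ‖y‖ := norm_pos_iff.2 hy
      have := (regInv_pos one_pos y).le
      rw [finrank_E3]
      calc ‖y‖ ^ 3 * ((4 * Real.pi)⁻¹ * (3 * regInv 1 y ^ 5))
          ≤ ‖y‖ ^ 3 * ((4 * Real.pi)⁻¹ * (3 * ‖y‖⁻¹ ^ 5)) := by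
            gcongr
            exact regInv_le 1 hy
        _ = _ := by field_simp
  have h := tendsto_integral_comp_smul_smul_of_integrable (μ := (volume : Measure E3))
    (φ := fun x => (4 * Real.pi)⁻¹ * (3 * regInv 1 x ^ 5))
    (fun y => by have := (regInv_pos one_pos y).le; positivity) integral_regInv_pow hdecay
    hgi hg.continuousAt
  have h' := (h.comp (tendsto_atTop_add_const_right _ (1 : ℝ)
    tendsto_natCast_atTop_atTop)).neg
  rw [sub_zero] at h'
  refine h'.congr fun n => ?_
  have hint : ∀ i, Integrable fun t => pd i (pd i (regKernel (n + 1))) t * f (x - t) := fun i =>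
    integrable_conv (ContDiff.pd (n := 0) (ContDiff.pd (n := 1)
      (contDiff_regKernel (hpos n)) i) i).continuous.locallyIntegrable hf hfc x
  simp only [conv, Function.comp_apply]
  rw [← integral_finsetSum _ fun i _ => hint i, ← integral_neg]
  congr 1
  ext t
  rw [← Finset.sum_mul, sum_pd_pd_regKernel (hpos n), regInv_scale (hpos n), finrank_E3]
  have := (hpos n).ne'
  simp only [smul_eq_mul]
  field_simp

/-- The Newtonian potential solves the Poisson equation. -/
lemma laplacian_conv_newtonKernel {f : E3 → ℝ} (hf : ContDiff ℝ 1 f) (hfc : HasCompactSupport f)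
    (x : E3) : (Δ (conv newtonKernel f)) x = -f x := by
  have hC2 : ContDiff ℝ 2 (conv newtonKernel f) := by
    have h := JointC.conv_newtonKernel (X := Unit) (f := fun _ => f) (k := 1) hfc.isCompact
      (fun _ y hy => image_eq_zero_of_notMem_tsupport hy) (JointC.of_contDiff (by simpa using hf))
    simpa using! h.contDiff ()
  rw [laplacian_eq_sum_pd hC2]
  -- Second derivatives of the kernel are not locally integrable, so one derivative stays on f. For
  -- the regularized kernels both go back to the kernel, where their sum is minus an approximate
  -- identity.
  have e : ∀ i, pd i (pd i (conv newtonKernel f)) x = conv (newtonGrad i) (pd i f) x := fun i => by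
    rw [pd_conv_newtonKernel hf.continuous hfc]
    exact (hasFDerivAt_conv (locallyIntegrable_newtonGrad i) hf hfc x).2 i
  simp only [e]
  have hpf : ∀ i, Continuous (pd i f) := fun i =>
    (ContDiff.pd (n := 0) (by simpa using hf) i).continuous
  refine tendsto_nhds_unique (tendsto_finsetSum _ fun i _ =>
    tendsto_conv_pd_regKernel (hpf i) (hfc.pd i) i x) ?_
  refine (tendsto_conv_sum_pd_pd_regKernel hf.continuous hfc x).congr fun n => ?_
  refine Finset.sum_congr rfl fun i _ => ?_
  rw [conv_pd_right (ContDiff.pd (n := 1) (contDiff_regKernel (by positivity)) i) hf hfc]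

lemma conv_nonneg {Q f : E3 → ℝ} (hQ : ∀ x, 0 ≤ Q x) (hf : ∀ x, 0 ≤ f x) (x : E3) :
    0 ≤ conv Q f x := integral_nonneg fun _ => mul_nonneg (hQ _) (hf _)

lemma conv_mono {Q f g : E3 → ℝ} (hQ : LocallyIntegrable Q) (hQ0 : ∀ x, 0 ≤ Q x)
    (hf : Continuous f) (hfc : HasCompactSupport f) (hg : Continuous g)
    (hgc : HasCompactSupport g) (h : ∀ x, f x ≤ g x) (x : E3) : conv Q f x ≤ conv Q g x :=
  integral_mono (integrable_conv hQ hf hfc x) (integrable_conv hQ hg hgc x) fun _ =>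
    mul_le_mul_of_nonneg_left (h _) (hQ0 _)

lemma conv_const_mul (Q f : E3 → ℝ) (a : ℝ) (x : E3) :
    conv Q (fun y => a * f y) x = a * conv Q f x := by
  rw [conv, conv, ← integral_const_mul]
  congr 1; ext t; ring

lemma conv_newtonKernel_pos {f : E3 → ℝ} (hf : Continuous f) (hfc : HasCompactSupport f)
    (hf0 : ∀ x, 0 ≤ f x) {y : E3} (hy : f y ≠ 0) (x : E3) : 0 < conv newtonKernel f x := by
  rw [conv, integral_pos_iff_support_of_nonneg
    (fun t => mul_nonneg (newtonKernel_nonneg t) (hf0 _))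
    (integrable_conv locallyIntegrable_newtonKernel hf hfc x)]
  have hopen : IsOpen {t | f (x - t) ≠ 0} :=
    isOpen_ne_fun (hf.comp (continuous_const.sub continuous_id)) continuous_const
  have hpos : 0 < volume {t | f (x - t) ≠ 0} :=
    hopen.measure_pos volume ⟨x - y, by simpa using hy⟩
  -- The origin is removed because `newtonKernel` takes the value 0 there, by 0⁻¹ = 0.
  rw [← measure_sdiff_null (measure_singleton (0 : E3))] at hpos
  refine hpos.trans_le (measure_mono fun t ht => ?_)
  have h1 : f (x - t) ≠ 0 := ht.1
  have h2 : t ≠ 0 := fun h => ht.2 (by simp [h])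
  have h3 : newtonKernel t ≠ 0 := by
    unfold newtonKernel
    have := norm_ne_zero_iff.2 h2
    have := Real.pi_ne_zero
    positivity
  exact mul_ne_zero h3 h1

lemma tendsto_conv_newtonKernel {f : E3 → ℝ} (hf : Continuous f) (hfc : HasCompactSupport f) :
    Tendsto (conv newtonKernel f) (cocompact E3) (𝓝 0) := by
  obtain ⟨R, hR⟩ := hfc.isCompact.isBounded.exists_norm_le
  have hint : Integrable f := hf.integrable_of_hasCompactSupport hfc
  set I := ∫ t, |f t| with hI
  have hI0 : 0 ≤ I := integral_nonneg fun _ => abs_nonneg _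
  have hbound : ∀ᶠ x in cocompact E3,
      ‖conv newtonKernel f x‖ ≤ (4 * Real.pi)⁻¹ * (‖x‖ - R)⁻¹ * I := by
    filter_upwards [tendsto_norm_cocompact_atTop.eventually_gt_atTop R] with x hx
    have hxR : 0 < ‖x‖ - R := sub_pos.2 hx
    have e : I = ∫ t, |f (x - t)| := (integral_sub_left_eq_self (fun t => |f t|) volume x).symm
    rw [e, ← integral_const_mul, conv]
    refine norm_integral_le_of_norm_le ((hint.comp_sub_left x).abs.const_mul _)
      (Eventually.of_forall fun t => ?_)
    rw [norm_mul, Real.norm_of_nonneg (newtonKernel_nonneg t), Real.norm_eq_abs]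
    by_cases ht : f (x - t) = 0
    · simp [ht]
    refine mul_le_mul_of_nonneg_right ?_ (abs_nonneg _)
    have h1 : ‖x - t‖ ≤ R := hR _ (subset_tsupport _ ht)
    have h2 : ‖x‖ - R ≤ ‖t‖ := by
      have : ‖x‖ ≤ ‖x - t‖ + ‖t‖ := by simpa using norm_add_le (x - t) t
      linarith
    unfold newtonKernel
    gcongr
  refine squeeze_zero_norm' hbound ?_
  have h1 : Tendsto (fun x : E3 => (‖x‖ - R)⁻¹) (cocompact E3) (𝓝 0) :=
    tendsto_inv_atTop_zero.comp
      (tendsto_atTop_add_const_right _ (-R) tendsto_norm_cocompact_atTop)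
  simpa using (h1.const_mul (4 * Real.pi)⁻¹).mul_const I

end NewtonPotential

/-! ### The equation solved for the Laplacian -/

/-- The equation `Δθ = -κ φ θ ^ (-α)` with its side conditions, a form of the generalized Poisson
equation that holds also where `θ` vanishes. -/
structure IsPoissonSol (κ : ℝ) (φ : E3 → ℝ) (a α : ℝ) (θ : E3 → ℝ) : Prop where
  contDiff : ContDiff ℝ 2 θ
  nonneg : ∀ x, 0 ≤ θ x
  laplacian : ∀ x, (Δ θ) x = -(κ * φ x * θ x ^ (-α))
  pos : ∀ x, φ x ≠ 0 → 0 < θ x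
  limit : Tendsto θ (cocompact E3) (𝓝 a)

section FromEquation

variable {G c : ℝ} {φ : E3 → ℝ} {a α : ℝ} {θ : E3 → ℝ}

/-- Where θ > 0 the equation gives the sign. If Δθ were positive at some point, then by continuity
also nearby, so θ would vanish on a neighbourhood and Δθ would be zero at the point. -/
lemma IsGenPoissonSolution.laplacian_nonpos (h : IsGenPoissonSolution G c φ a α θ) (hG : 0 < G)
    (hφ : ∀ x, 0 ≤ φ x) (x : E3) : (Δ θ) x ≤ 0 := by
  have hcoef : ∀ y, -4 * Real.pi * (G / (2 * c ^ 2)) * φ y ≤ 0 := fun y => by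
    have h1 : 0 ≤ 4 * Real.pi * (G / (2 * c ^ 2)) := by positivity
    nlinarith [mul_nonneg h1 (hφ y)]
  have hpos : ∀ y, 0 < θ y → (Δ θ) y ≤ 0 := fun y hy => by
    have h1 : θ y ^ α * (Δ θ) y ≤ 0 := (h.equation y).trans_le (hcoef y)
    have h2 : 0 < θ y ^ α := Real.rpow_pos_of_pos hy α
    by_contra! h3
    exact absurd (mul_pos h2 h3) (not_lt.2 h1)
  by_contra! hx
  have hcont : Continuous (Δ θ) := by
    rw [funext (laplacian_eq_sum_pd h.contDiff)]
    exact continuous_finsetSum _ fun i _ => (ContDiff.pd (n := 0)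
      (ContDiff.pd (n := 1) (by exact_mod_cast h.contDiff) i) i).continuous
  have hev : θ =ᶠ[𝓝 x] fun _ => 0 := by
    filter_upwards [hcont.continuousAt.eventually_const_lt hx] with y hy
    by_contra hne
    exact absurd (hpos y ((h.nonneg y).lt_of_ne' hne)) (not_le.2 hy)
  rw [(InnerProductSpace.laplacian_congr_nhds hev).eq_of_nhds] at hx
  simp at hx

lemma IsGenPoissonSolution.isPoissonSol (h : IsGenPoissonSolution G c φ a α θ) (hG : 0 < G)
    (hc : 0 < c) (hφ : ∀ x, 0 ≤ φ x) :
    IsPoissonSol (4 * Real.pi * (G / (2 * c ^ 2))) φ a α θ := by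
  have hκ : 0 < 4 * Real.pi * (G / (2 * c ^ 2)) := by positivity
  set κ := 4 * Real.pi * (G / (2 * c ^ 2)) with hκd
  have heq : ∀ x, θ x ^ α * (Δ θ) x = -(κ * φ x) := fun x => by
    rw [h.equation x]; ring
  have hle := h.laplacian_nonpos hG hφ
  have hpos : ∀ x, φ x ≠ 0 → 0 < θ x := by
    intro x hx
    have hne : θ x ^ α * (Δ θ) x ≠ 0 := by
      rw [heq]; exact neg_ne_zero.2 (mul_ne_zero hκ.ne' hx)
    refine (h.nonneg x).lt_of_ne' fun h0 => hne ?_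
    have := IsLocalMin.laplacian_nonneg h.contDiff (x := x)
      (Eventually.of_forall fun y => by rw [h0]; exact h.nonneg y)
    rw [le_antisymm (hle x) this, mul_zero]
  refine ⟨h.contDiff, h.nonneg, fun x => ?_, hpos, h.limit⟩
  rcases (h.nonneg x).eq_or_lt with h0 | h0
  · have h1 := IsLocalMin.laplacian_nonneg h.contDiff (x := x)
      (Eventually.of_forall fun y => by rw [← h0]; exact h.nonneg y)
    have h2 : φ x = 0 := by
      by_contra hne
      exact (hpos x hne).ne h0
    rw [le_antisymm (hle x) h1, h2]
    simp
  · have h1 : θ x ^ (-α) * θ x ^ α = 1 := by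
      rw [← Real.rpow_add h0]; simp
    calc (Δ θ) x = θ x ^ (-α) * (θ x ^ α * (Δ θ) x) := by rw [← mul_assoc, h1, one_mul]
      _ = _ := by rw [heq]; ring

end FromEquation

lemma IsPoissonSol.isGenPoissonSolution {G c : ℝ} {φ : E3 → ℝ} {a α : ℝ} {θ : E3 → ℝ}
    (h : IsPoissonSol (4 * Real.pi * (G / (2 * c ^ 2))) φ a α θ) :
    IsGenPoissonSolution G c φ a α θ := by
  refine ⟨h.contDiff, h.nonneg, fun x => ?_, h.limit⟩
  rw [h.laplacian]
  by_cases hx : φ x = 0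
  · simp [hx]
  · have h1 : θ x ^ α * θ x ^ (-α) = 1 := by
      rw [← Real.rpow_add (h.pos x hx)]; simp
    linear_combination (-(4 * Real.pi * (G / (2 * c ^ 2)) * φ x)) * h1

/-! ### Comparison of solutions -/

section Comparison

variable {κ : ℝ} {φ : E3 → ℝ} {a b α β : ℝ} {θ τ : E3 → ℝ}

lemma IsPoissonSol.laplacian_nonpos (h : IsPoissonSol κ φ a α θ) (hκ : 0 ≤ κ)
    (hφ : ∀ x, 0 ≤ φ x) (x : E3) : (Δ θ) x ≤ 0 := by
  rw [h.laplacian, neg_nonpos]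
  exact mul_nonneg (mul_nonneg hκ (hφ x)) (Real.rpow_nonneg (h.nonneg x) _)

/-- Comparison of `p θ` with `q τ + d`. -/
lemma IsPoissonSol.mul_le_mul_add (h : IsPoissonSol κ φ a α θ) (h' : IsPoissonSol κ φ b β τ)
    (hκ : 0 ≤ κ) (hφ : ∀ x, 0 ≤ φ x) {p q d : ℝ} (hl : p * a ≤ q * b + d)
    (hcomp : ∀ x, 0 < θ x → 0 < τ x → q * τ x + d < p * θ x →
      p * θ x ^ (-α) ≤ q * τ x ^ (-β)) (x : E3) : p * θ x ≤ q * τ x + d := by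
  have c1 : ContDiff ℝ 2 (p • θ) := h.contDiff.const_smul p
  have c2 : ContDiff ℝ 2 (q • τ) := h'.contDiff.const_smul q
  have c3 : ContDiff ℝ 2 (p • θ - q • τ) := c1.sub c2
  have c4 : ContDiff ℝ 2 fun _ : E3 => d := contDiff_const
  have hlim : Tendsto (p • θ - q • τ - fun _ => d) (cocompact E3) (𝓝 (p • a - q • b - d)) :=
    ((h.limit.const_smul p).sub (h'.limit.const_smul q)).sub tendsto_const_nhds
  -- The difference has Laplacian κφ(qτ^(-β) - pθ^(-α)), and `hcomp` makes this nonnegative where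
  -- the difference is positive. Where φ = 0 it vanishes.
  have := le_zero_of_laplacian_nonneg (w := p • θ - q • τ - fun _ => d) (c3.sub c4) hlim
    (by simp only [smul_eq_mul]; linarith) (fun y hy => by
      rw [ContDiffAt.laplacian_sub c3.contDiffAt c4.contDiffAt,
        ContDiffAt.laplacian_sub c1.contDiffAt c2.contDiffAt,
        InnerProductSpace.laplacian_smul _ h.contDiff.contDiffAt,
        InnerProductSpace.laplacian_smul _ h'.contDiff.contDiffAt, h.laplacian, h'.laplacian]
      simp only [InnerProductSpace.laplacian_const, smul_eq_mul, Pi.sub_apply, Pi.smul_apply,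
        Pi.zero_apply] at hy ⊢
      by_cases h0 : φ y = 0
      · simp [h0]
      have h1 := hcomp y (h.pos y h0) (h'.pos y h0) (by linarith)
      have h2 := mul_le_mul_of_nonneg_left h1 (mul_nonneg hκ (hφ y))
      linarith) x
  simp only [Pi.sub_apply, Pi.smul_apply, smul_eq_mul] at this
  linarith

lemma IsPoissonSol.mono (h : IsPoissonSol κ φ a α θ) (h' : IsPoissonSol κ φ b α τ) (hκ : 0 ≤ κ)
    (hφ : ∀ x, 0 ≤ φ x) (hα : 0 ≤ α) (hab : a ≤ b) (x : E3) : θ x ≤ τ x := by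
  have := h.mul_le_mul_add h' hκ hφ (p := 1) (q := 1) (d := 0) (by linarith)
    (fun y _ hτ hlt => by
      simp only [one_mul, add_zero] at hlt ⊢
      exact Real.rpow_le_rpow_of_nonpos hτ hlt.le (by linarith)) x
  linarith

lemma IsPoissonSol.le_add_sub (h : IsPoissonSol κ φ a α θ) (h' : IsPoissonSol κ φ b α τ)
    (hκ : 0 ≤ κ) (hφ : ∀ x, 0 ≤ φ x) (hα : 0 ≤ α) (hab : a ≤ b) (x : E3) :
    τ x ≤ θ x + (b - a) := by
  have := h'.mul_le_mul_add h hκ hφ (p := 1) (q := 1) (d := b - a) (by linarith)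
    (fun y _ hτ hlt => by
      simp only [one_mul] at hlt ⊢
      exact Real.rpow_le_rpow_of_nonpos hτ (by linarith) (by linarith)) x
  linarith

lemma IsPoissonSol.unique (h : IsPoissonSol κ φ a α θ) (h' : IsPoissonSol κ φ a α τ) (hκ : 0 ≤ κ)
    (hφ : ∀ x, 0 ≤ φ x) (hα : 0 ≤ α) : θ = τ :=
  funext fun x => le_antisymm (h.mono h' hκ hφ hα le_rfl x) (h'.mono h hκ hφ hα le_rfl x)

lemma isPoissonSol_const (κ : ℝ) (ha : 0 ≤ a) (hφ : ∀ x, φ x = 0) :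
    IsPoissonSol κ φ a α fun _ => a :=
  ⟨contDiff_const, fun _ => ha, fun x => by simp [hφ], fun x hx => absurd (hφ x) hx,
    tendsto_const_nhds⟩

lemma IsPoissonSol.boundary_le (h : IsPoissonSol κ φ a α θ) (hκ : 0 ≤ κ) (hφ : ∀ x, 0 ≤ φ x)
    (x : E3) : a ≤ θ x := by
  have c : ContDiff ℝ 2 fun _ : E3 => a := contDiff_const
  have := le_zero_of_laplacian_nonneg (c.sub h.contDiff) (tendsto_const_nhds.sub h.limit)
    (sub_self a).le (fun y _ => by
      have e : (fun x => a - θ x) = (fun _ : E3 => a) - θ := rfl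
      rw [e, ContDiffAt.laplacian_sub c.contDiffAt h.contDiff.contDiffAt]
      simpa using h.laplacian_nonpos hκ hφ y) x
  linarith

lemma IsPoissonSol.pos_of_nontrivial (h : IsPoissonSol κ φ a α θ) (hκ : 0 ≤ κ)
    (hφ : ∀ x, 0 ≤ φ x) (hne : 0 < a ∨ ∃ x, φ x ≠ 0) (x : E3) : 0 < θ x := by
  rcases hne with ha | ⟨y, hy⟩
  · exact ha.trans_le (h.boundary_le hκ hφ x)
  · exact pos_of_laplacian_nonpos h.contDiff h.nonneg h.limit (h.laplacian_nonpos hκ hφ)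
      (h.pos y hy) x

/-- The scaled sources are (a/τ)^β and (a/θ)^α. Since a/τ ≤ 1, raising the exponent lowers the
power; where the inequality fails, θ ≤ τ because a^β ≤ a^α. -/
lemma IsPoissonSol.boundary_rpow_mul_le (h : IsPoissonSol κ φ a α θ)
    (h' : IsPoissonSol κ φ a β τ) (hκ : 0 ≤ κ) (hφ : ∀ x, 0 ≤ φ x) (hα : 0 ≤ α) (hαβ : α ≤ β)
    (ha : 0 < a) (ha1 : a ≤ 1) (x : E3) : a ^ β * τ x ≤ a ^ α * θ x := by
  have hle : a ^ β ≤ a ^ α := Real.rpow_le_rpow_of_exponent_ge ha ha1 hαβ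
  have := h'.mul_le_mul_add h hκ hφ (p := a ^ β) (q := a ^ α) (d := 0)
    (by rw [add_zero]; gcongr) (fun y hτ hθ hlt => by
      rw [add_zero] at hlt
      have hθτ : θ y ≤ τ y := by
        by_contra! hcon
        have : a ^ β * τ y ≤ a ^ α * θ y := by gcongr
        linarith
      rw [Real.rpow_neg hτ.le, Real.rpow_neg hθ.le, ← div_eq_mul_inv, ← div_eq_mul_inv,
        ← Real.div_rpow ha.le hτ.le, ← Real.div_rpow ha.le hθ.le]
      calc (a / τ y) ^ β ≤ (a / τ y) ^ α :=
            Real.rpow_le_rpow_of_exponent_ge (by positivity)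
              ((div_le_one hτ).2 (h'.boundary_le hκ hφ y)) hαβ
        _ ≤ (a / θ y) ^ α := by gcongr) x
  linarith

/-- The mirror image of `IsPoissonSol.boundary_rpow_mul_le`: M/τ ≥ 1, so raising the exponent now
raises the power. The two together bound the difference of solutions on both sides. -/
lemma IsPoissonSol.bound_rpow_mul_le (h : IsPoissonSol κ φ a α θ) (h' : IsPoissonSol κ φ a β τ)
    (hκ : 0 ≤ κ) (hφ : ∀ x, 0 ≤ φ x) (hα : 0 ≤ α) (hαβ : α ≤ β) (ha : 0 ≤ a) {M : ℝ}
    (hM : 1 ≤ M) (hτM : ∀ x, τ x ≤ M) (x : E3) : M ^ α * θ x ≤ M ^ β * τ x := by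
  have hM0 : 0 < M := by linarith
  have hle : M ^ α ≤ M ^ β := Real.rpow_le_rpow_of_exponent_le hM hαβ
  have := h.mul_le_mul_add h' hκ hφ (p := M ^ α) (q := M ^ β) (d := 0)
    (by rw [add_zero]; gcongr) (fun y hθ hτ hlt => by
      rw [add_zero] at hlt
      have hτθ : τ y ≤ θ y := by
        by_contra! hcon
        have : M ^ α * θ y ≤ M ^ β * τ y := by gcongr
        linarith
      rw [Real.rpow_neg hτ.le, Real.rpow_neg hθ.le, ← div_eq_mul_inv, ← div_eq_mul_inv,
        ← Real.div_rpow hM0.le hτ.le, ← Real.div_rpow hM0.le hθ.le]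
      calc (M / θ y) ^ α ≤ (M / τ y) ^ α := by gcongr
        _ ≤ (M / τ y) ^ β :=
            Real.rpow_le_rpow_of_exponent_le ((one_le_div hτ).2 (hτM y)) hαβ) x
  linarith

/-- Solutions with a boundary value bounded away from zero depend continuously on the
exponent. -/
lemma IsPoissonSol.abs_sub_le_of_le_boundary (h : IsPoissonSol κ φ a α θ)
    (h' : IsPoissonSol κ φ a β τ) (hκ : 0 ≤ κ) (hφ : ∀ x, 0 ≤ φ x) (hα : 0 ≤ α) (hβ : 0 ≤ β)
    {δ M : ℝ} (hδ : 0 < δ) (hδa : δ ≤ a) (ha1 : a ≤ 1) (hM : 1 ≤ M) (hθM : ∀ x, θ x ≤ M)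
    (hτM : ∀ x, τ x ≤ M) (x : E3) : |θ x - τ x| ≤ M * ((M / δ) ^ |α - β| - 1) := by
  wlog hαβ : α ≤ β generalizing α β θ τ
  · have := this h' h hβ hα hτM hθM (le_of_not_ge hαβ)
    rwa [abs_sub_comm, abs_sub_comm α β]
  have ha : 0 < a := hδ.trans_le hδa
  have hM0 : 0 < M := by linarith
  set η := |α - β| with hη
  have hη0 : 0 ≤ η := abs_nonneg _
  have hβe : β = α + η := by rw [hη, abs_of_nonpos (by linarith)]; ring
  have h1 := h.boundary_rpow_mul_le h' hκ hφ hα hαβ ha ha1 x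
  have h2 := h.bound_rpow_mul_le h' hκ hφ hα hαβ ha.le hM hτM x
  -- Cancelling a^α and M^α leaves a^η τ ≤ θ and θ ≤ M^η τ. The single factor (M/δ)^η serves for
  -- both, since δ ≤ a ≤ 1 ≤ M.
  rw [hβe, Real.rpow_add ha, mul_assoc, mul_le_mul_iff_right₀ (Real.rpow_pos_of_pos ha α)] at h1
  rw [hβe, Real.rpow_add hM0, mul_assoc, mul_le_mul_iff_right₀ (Real.rpow_pos_of_pos hM0 α)] at h2
  have hθ0 := h.nonneg x
  have hτ0 := h'.nonneg x
  have hA : M ^ η ≤ (M / δ) ^ η := by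
    refine Real.rpow_le_rpow hM0.le ?_ hη0
    rw [le_div_iff₀ hδ]
    nlinarith
  have hB : 1 ≤ a ^ η * (M / δ) ^ η := by
    rw [← Real.mul_rpow ha.le (by positivity)]
    refine Real.one_le_rpow ?_ hη0
    rw [mul_div_assoc', one_le_div hδ]
    nlinarith
  have hC : 1 ≤ (M / δ) ^ η := (Real.one_le_rpow hM hη0).trans hA
  have hτ' : τ x ≤ (M / δ) ^ η * θ x := by
    calc τ x = 1 * τ x := (one_mul _).symm
      _ ≤ (a ^ η * (M / δ) ^ η) * τ x := by gcongr
      _ = (M / δ) ^ η * (a ^ η * τ x) := by ring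
      _ ≤ (M / δ) ^ η * θ x := by gcongr
  have hθ' : θ x ≤ (M / δ) ^ η * τ x := h2.trans (by gcongr)
  have e1 : ((M / δ) ^ η - 1) * θ x ≤ ((M / δ) ^ η - 1) * M :=
    mul_le_mul_of_nonneg_left (hθM x) (by linarith)
  have e2 : ((M / δ) ^ η - 1) * τ x ≤ ((M / δ) ^ η - 1) * M :=
    mul_le_mul_of_nonneg_left (hτM x) (by linarith)
  rw [abs_le]
  constructor <;> linarith

end Comparison

/-! ### Integral representation and bootstrapping -/

section Representation

variable {κ : ℝ} {φ : E3 → ℝ} {a α : ℝ} {θ : E3 → ℝ}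

/-- The source term as an exponential, for positive `θ`. -/
lemma rpow_neg_eq_exp (hθ : ∀ x, 0 < θ x) (x : E3) :
    θ x ^ (-α) = Real.exp (-α * Real.log (θ x)) := by
  rw [Real.rpow_def_of_pos (hθ x), mul_comm]

lemma hasCompactSupport_source (hφc : HasCompactSupport φ) (g : E3 → ℝ) :
    HasCompactSupport fun x => κ * φ x * g x :=
  HasCompactSupport.mul_right (f' := g) (HasCompactSupport.mul_left (f := fun _ => κ) hφc)

lemma contDiff_source (hφ : ContDiff ℝ ∞ φ) {n : ℕ} (hθ : ContDiff ℝ n θ)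
    (hpos : ∀ x, 0 < θ x) : ContDiff ℝ n fun x => κ * φ x * θ x ^ (-α) :=
  (contDiff_const.mul (hφ.of_le (by exact_mod_cast le_top))).mul
    (hθ.rpow_const_of_ne fun x => (hpos x).ne')

/-- A positive solution is the sum of its boundary value and a Newtonian potential. -/
lemma IsPoissonSol.eq_add_conv (h : IsPoissonSol κ φ a α θ) (hφ : ContDiff ℝ ∞ φ)
    (hφc : HasCompactSupport φ) (hpos : ∀ x, 0 < θ x) (x : E3) :
    θ x = a + conv newtonKernel (fun y => κ * φ y * θ y ^ (-α)) x := by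
  set f : E3 → ℝ := fun y => κ * φ y * θ y ^ (-α) with hf
  have hfC : ContDiff ℝ 1 f :=
    contDiff_source hφ (n := 1) (h.contDiff.of_le (by norm_num)) hpos
  have hfc : HasCompactSupport f := hasCompactSupport_source hφc _
  set N := conv newtonKernel f with hN
  have hNC : ContDiff ℝ 2 N := by
    have h := JointC.conv_newtonKernel (X := Unit) (f := fun _ => f) (k := 1) hfc.isCompact
      (fun _ y hy => image_eq_zero_of_notMem_tsupport hy)
      (JointC.of_contDiff (by simpa using hfC))
    simpa using! h.contDiff ()
  have hNl := tendsto_conv_newtonKernel hfC.continuous hfc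
  have c0 : ContDiff ℝ 2 fun _ : E3 => a := contDiff_const
  have c1 : ContDiff ℝ 2 (θ - N) := h.contDiff.sub hNC
  set w : E3 → ℝ := θ - N - fun _ => a with hw
  have c2 : ContDiff ℝ 2 w := c1.sub c0
  have hΔ : ∀ y, (Δ w) y = 0 := fun y => by
    rw [hw, ContDiffAt.laplacian_sub c1.contDiffAt c0.contDiffAt,
      ContDiffAt.laplacian_sub h.contDiff.contDiffAt hNC.contDiffAt, h.laplacian,
      laplacian_conv_newtonKernel hfC hfc]
    simp [hf]
  have hlim : Tendsto w (cocompact E3) (𝓝 0) := by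
    have := (h.limit.sub hNl).sub (tendsto_const_nhds (x := a))
    simp only [sub_zero, sub_self] at this
    exact this
  have hlim' : Tendsto (-w) (cocompact E3) (𝓝 0) := by
    have := hlim.neg
    rwa [neg_zero] at this
  have h1 := le_zero_of_laplacian_nonneg c2 hlim le_rfl (fun y _ => (hΔ y).ge) x
  have h2 := le_zero_of_laplacian_nonneg c2.neg hlim' le_rfl (fun y _ => by
    have := congrFun (InnerProductSpace.laplacian_neg (f := w)) y
    rw [Pi.neg_apply, hΔ, neg_zero] at this
    exact this.ge) x
  simp only [hw, Pi.sub_apply] at h1 h2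
  linarith

/-- Bootstrapping: a family of positive continuous solutions of the integral equation is smooth,
jointly with the parameters. -/
lemma jointC_of_integral_equation {X : Type*} [TopologicalSpace X] {Θ : X → E3 → ℝ}
    {A B : X → ℝ} (hA : Continuous A) (hB : Continuous B) (hφ : ContDiff ℝ ∞ φ)
    (hφc : HasCompactSupport φ) (hΘ : Continuous fun q : X × E3 => Θ q.1 q.2)
    (hpos : ∀ p x, 0 < Θ p x)
    (heq : ∀ p x, Θ p x = A p + conv newtonKernel (fun y => κ * φ y * Θ p y ^ (-B p)) x)
    (k : ℕ) : JointC k Θ := by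
  induction k with
  | zero => exact hΘ
  | succ k ih =>
    have h1 : JointC k fun p y => κ * φ y * Θ p y ^ (-B p) := by
      simp only [rpow_neg_eq_exp (hpos _)]
      exact (JointC.of_contDiff (contDiff_const.mul (hφ.of_le (by exact_mod_cast le_top)))).mul
        ((JointC.parameter hB.neg).mul (ih.log fun p x => (hpos p x).ne')).exp
    have h2 := (JointC.parameter (k := k + 1) hA).add
      (JointC.conv_newtonKernel (K := tsupport φ) hφc.isCompact (fun p x hx => by
        simp [image_eq_zero_of_notMem_tsupport hx]) h1)
    have e : Θ = fun p x => A p + conv newtonKernel (fun y => κ * φ y * Θ p y ^ (-B p)) x := by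
      ext p x; exact heq p x
    rw [e]
    exact h2

lemma isPoissonSol_of_integral_equation (hφ : ContDiff ℝ ∞ φ) (hφc : HasCompactSupport φ)
    (hθ : Continuous θ) (hpos : ∀ x, 0 < θ x)
    (heq : ∀ x, θ x = a + conv newtonKernel (fun y => κ * φ y * θ y ^ (-α)) x) :
    IsPoissonSol κ φ a α θ := by
  have hJ : ∀ k : ℕ, ContDiff ℝ k θ := fun k =>
    (jointC_of_integral_equation (X := Unit) (Θ := fun _ => θ) (A := fun _ => a)
      (B := fun _ => α) continuous_const continuous_const hφ hφc (hθ.comp continuous_snd)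
      (fun _ => hpos) (fun _ => heq) k).contDiff ()
  set f : E3 → ℝ := fun y => κ * φ y * θ y ^ (-α) with hf
  have hfC : ContDiff ℝ 1 f := contDiff_source hφ (n := 1) (hJ 1) hpos
  have hfc : HasCompactSupport f := hasCompactSupport_source hφc _
  have c0 : ContDiff ℝ 2 fun _ : E3 => a := contDiff_const
  have hθ2 : ContDiff ℝ 2 θ := hJ 2
  have e : conv newtonKernel f = θ - fun _ => a := by
    ext x; simp [heq x]
  refine ⟨hθ2, fun x => (hpos x).le, fun x => ?_, fun x _ => hpos x, ?_⟩
  · have h := laplacian_conv_newtonKernel hfC hfc x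
    rw [e, ContDiffAt.laplacian_sub hθ2.contDiffAt c0.contDiffAt] at h
    simpa using h
  · have h := (tendsto_conv_newtonKernel hfC.continuous hfc).const_add a
    rw [add_zero] at h
    exact h.congr fun x => (heq x).symm

end Representation

/-! ### Existence -/

section Existence

open MeasureTheory BoundedContinuousFunction

variable {κ : ℝ} {φ : E3 → ℝ} {a α : ℝ} {θ : E3 → ℝ}

/-- The radial retraction of `ℝ³` onto the closed ball of radius `R`. -/
noncomputable def ballRetraction (R : ℝ) (x : E3) : E3 := (R / max R ‖x‖) • x

lemma continuous_ballRetraction {R : ℝ} (hR : 0 < R) : Continuous (ballRetraction R) :=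
  (continuous_const.div (continuous_const.max continuous_norm) fun _ =>
    (lt_max_of_lt_left hR).ne').smul continuous_id

lemma ballRetraction_mem {R : ℝ} (hR : 0 < R) (x : E3) :
    ballRetraction R x ∈ Metric.closedBall (0 : E3) R := by
  have h : 0 < max R ‖x‖ := lt_max_of_lt_left hR
  rw [mem_closedBall_zero_iff, ballRetraction, norm_smul, Real.norm_of_nonneg (by positivity),
    div_mul_eq_mul_div, div_le_iff₀ h]
  exact mul_le_mul_of_nonneg_left (le_max_right _ _) hR.le

lemma ballRetraction_eq {R : ℝ} (hR : 0 < R) {x : E3} (hx : x ∈ Metric.closedBall (0 : E3) R) :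
    ballRetraction R x = x := by
  rw [mem_closedBall_zero_iff] at hx
  rw [ballRetraction, max_eq_left hx, div_self hR.ne', one_smul]

/-- The potential generated by the source `κ φ exp (-α g)`. -/
noncomputable def expPotential (κ : ℝ) (φ : E3 → ℝ) (a α : ℝ) (g : E3 → ℝ) (x : E3) : ℝ :=
  a + conv newtonKernel (fun y => κ * φ y * Real.exp (-α * g y)) x

lemma continuous_expSource (hφ : Continuous φ) {g : E3 → ℝ} (hg : Continuous g) :
    Continuous fun y => κ * φ y * Real.exp (-α * g y) := by fun_prop

lemma continuous_expPotential (hφ : Continuous φ) (hφc : HasCompactSupport φ) {g : E3 → ℝ}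
    (hg : Continuous g) : Continuous (expPotential κ φ a α g) := by
  have hs := continuous_expSource (κ := κ) (α := α) hφ hg
  have hsc : HasCompactSupport fun y => κ * φ y * Real.exp (-α * g y) :=
    hasCompactSupport_source hφc _
  refine continuous_const.add (continuous_iff_continuousAt.2 fun x => ?_)
  exact (hasFDerivAt_conv_newtonKernel hs hsc x).continuousAt

lemma expPotential_pos (hκ : 0 < κ) (hφ : Continuous φ) (hφc : HasCompactSupport φ)
    (hφ0 : ∀ x, 0 ≤ φ x) (hne : ∃ x, φ x ≠ 0) (ha : 0 ≤ a) {g : E3 → ℝ} (hg : Continuous g)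
    (x : E3) : 0 < expPotential κ φ a α g x := by
  obtain ⟨y, hy⟩ := hne
  refine add_pos_of_nonneg_of_pos ha (conv_newtonKernel_pos (y := y)
    (continuous_expSource hφ hg) (hasCompactSupport_source hφc _)
    (fun x => mul_nonneg (mul_nonneg hκ.le (hφ0 x)) (Real.exp_pos _).le) ?_ x)
  exact mul_ne_zero (mul_ne_zero hκ.ne' hy) (Real.exp_pos _).ne'

/-- Changing g by at most d changes the source by a factor of at most exp(αd), and a ≤ exp(αd) a.
After taking logarithms this is the Lipschitz bound with constant α. -/
lemma expPotential_le (hκ : 0 < κ) (hφ : Continuous φ) (hφc : HasCompactSupport φ)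
    (hφ0 : ∀ x, 0 ≤ φ x) (ha : 0 ≤ a) (hα : 0 ≤ α) {g h : E3 → ℝ}
    (hg : Continuous g) (hh : Continuous h) {d : ℝ} (hd : 0 ≤ d) (hgh : ∀ x, |g x - h x| ≤ d)
    (x : E3) : expPotential κ φ a α g x ≤ Real.exp (α * d) * expPotential κ φ a α h x := by
  have h1 : 1 ≤ Real.exp (α * d) := Real.one_le_exp (by positivity)
  have hle : conv newtonKernel (fun y => κ * φ y * Real.exp (-α * g y)) x ≤
      conv newtonKernel (fun y => Real.exp (α * d) * (κ * φ y * Real.exp (-α * h y))) x := by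
    refine conv_mono locallyIntegrable_newtonKernel newtonKernel_nonneg
      (continuous_expSource hφ hg) (hasCompactSupport_source hφc _)
      (continuous_const.mul (continuous_expSource hφ hh))
      (HasCompactSupport.mul_left (f := fun _ => Real.exp (α * d))
        (hasCompactSupport_source hφc _)) (fun y => ?_) x
    have h2 : Real.exp (-α * g y) ≤ Real.exp (α * d) * Real.exp (-α * h y) := by
      rw [← Real.exp_add, Real.exp_le_exp]
      have := mul_le_mul_of_nonneg_left (abs_le.1 (hgh y)).1 hα
      linarith
    calc κ * φ y * Real.exp (-α * g y)
        ≤ κ * φ y * (Real.exp (α * d) * Real.exp (-α * h y)) :=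
          mul_le_mul_of_nonneg_left h2 (mul_nonneg hκ.le (hφ0 y))
      _ = Real.exp (α * d) * (κ * φ y * Real.exp (-α * h y)) := by ring
  rw [conv_const_mul] at hle
  rw [expPotential, expPotential, mul_add]
  have := mul_le_mul_of_nonneg_right h1 ha
  linarith

/-- Existence for exponents below `1`, by a contraction argument for `log θ`. -/
lemma exists_isPoissonSol_of_lt_one (hκ : 0 < κ) (hφ : ContDiff ℝ ∞ φ)
    (hφc : HasCompactSupport φ) (hφ0 : ∀ x, 0 ≤ φ x) (hne : ∃ x, φ x ≠ 0) (ha : 0 ≤ a)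
    (hα : 0 ≤ α) (hα1 : α < 1) : ∃ θ, IsPoissonSol κ φ a α θ := by
  have hφ' := hφ.continuous
  obtain ⟨R₀, hR₀⟩ := hφc.isCompact.isBounded.subset_closedBall (0 : E3)
  set R := max R₀ 1
  have hR : 0 < R := lt_max_of_lt_right one_pos
  have hsub : tsupport φ ⊆ Metric.closedBall 0 R :=
    hR₀.trans (Metric.closedBall_subset_closedBall (le_max_left _ _))
  have hlog : ∀ g : E3 →ᵇ ℝ, Continuous fun x => Real.log (expPotential κ φ a α g x) := fun g =>
    (continuous_expPotential hφ' hφc g.continuous).log fun x =>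
      (expPotential_pos hκ hφ' hφc hφ0 hne ha g.continuous x).ne'
  have hbdd : ∀ g : E3 →ᵇ ℝ, ∃ C, ∀ x,
      ‖Real.log (expPotential κ φ a α g (ballRetraction R x))‖ ≤ C := fun g => by
    obtain ⟨C, hC⟩ := (isCompact_closedBall (0 : E3) R).exists_bound_of_continuousOn
      (hlog g).continuousOn
    exact ⟨C, fun x => hC _ (ballRetraction_mem hR x)⟩
  choose C hC using hbdd
  -- For a = 0 the logarithm is unbounded at infinity. Only its values on the support of φ enter the
  -- source, so composing with the retraction onto a ball loses nothing and keeps T inside a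
  -- complete space.
  let T : (E3 →ᵇ ℝ) → (E3 →ᵇ ℝ) := fun g => ofNormedAddCommGroup
    (fun x => Real.log (expPotential κ φ a α g (ballRetraction R x)))
    ((hlog g).comp (continuous_ballRetraction hR)) (C g) (hC g)
  have hT : ∀ g h : E3 →ᵇ ℝ, dist (T g) (T h) ≤ α * dist g h := by
    intro g h
    have hd : 0 ≤ dist g h := dist_nonneg
    have key : ∀ (g h : E3 →ᵇ ℝ) x, Real.log (expPotential κ φ a α g x) ≤
        α * dist g h + Real.log (expPotential κ φ a α h x) := fun g h x => by
      have hp := expPotential_pos (α := α) hκ hφ' hφc hφ0 hne ha g.continuous x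
      have hq := expPotential_pos (α := α) hκ hφ' hφc hφ0 hne ha h.continuous x
      have := Real.log_le_log hp (expPotential_le (a := a) hκ hφ' hφc hφ0 ha hα g.continuous
        h.continuous dist_nonneg
        (fun y => by rw [← Real.dist_eq]; exact dist_coe_le_dist y) x)
      rwa [Real.log_mul (Real.exp_pos _).ne' hq.ne', Real.log_exp] at this
    rw [BoundedContinuousFunction.dist_le (by positivity)]
    intro x
    rw [Real.dist_eq, abs_le]
    have h1 := key g h (ballRetraction R x)
    have h2 := key h g (ballRetraction R x)
    rw [dist_comm h g] at h2
    simp only [T, coe_ofNormedAddCommGroup]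
    constructor <;> linarith
  have hcontr : ContractingWith ⟨α, hα⟩ T :=
    ⟨by exact_mod_cast hα1, LipschitzWith.of_dist_le_mul hT⟩
  set g := hcontr.fixedPoint T
  have hg : T g = g := hcontr.fixedPoint_isFixedPt
  have hpos := expPotential_pos (α := α) hκ hφ' hφc hφ0 hne ha g.continuous
  refine ⟨expPotential κ φ a α g, isPoissonSol_of_integral_equation hφ hφc
    (continuous_expPotential hφ' hφc g.continuous) hpos fun x => ?_⟩
  rw [expPotential]
  congr 2
  ext y
  by_cases hy : φ y = 0
  · simp [hy]
  have hgy : g y = Real.log (expPotential κ φ a α g y) := by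
    have h1 : T g y = Real.log (expPotential κ φ a α g (ballRetraction R y)) := rfl
    rwa [hg, ballRetraction_eq hR (hsub (subset_tsupport φ hy))] at h1
  rw [rpow_neg_eq_exp hpos, ← hgy]

/-- An upper bound, uniform in the parameters. -/
lemma exists_uniform_bound (hκ : 0 < κ) (hφ : ContDiff ℝ ∞ φ) (hφc : HasCompactSupport φ)
    (hφ0 : ∀ x, 0 ≤ φ x) : ∃ M : ℝ, 1 ≤ M ∧ ∀ a α θ, a ≤ 1 → 0 ≤ α → IsPoissonSol κ φ a α θ →
      ∀ x, θ x ≤ M := by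
  set f : E3 → ℝ := fun y => κ * φ y with hf
  have hfC : ContDiff ℝ ∞ f := contDiff_const.mul hφ
  have hfc : HasCompactSupport f := HasCompactSupport.mul_left (f := fun _ => κ) hφc
  -- This solves the problem for a = 1, α = 0. Where θ > v ≥ 1 one has θ^(-α) ≤ 1, so v dominates
  -- every solution.
  set v : E3 → ℝ := fun x => 1 + conv newtonKernel f x
  have hf0 : ∀ x, 0 ≤ f x := fun x => mul_nonneg hκ.le (hφ0 x)
  have hv1 : ∀ x, 1 ≤ v x := fun x => by
    have := conv_nonneg newtonKernel_nonneg hf0 x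
    simp only [v]; linarith
  have hv : IsPoissonSol κ φ 1 0 v := by
    refine isPoissonSol_of_integral_equation hφ hφc (continuous_const.add
      (continuous_iff_continuousAt.2 fun x =>
        (hasFDerivAt_conv_newtonKernel hfC.continuous hfc x).continuousAt))
      (fun x => one_pos.trans_le (hv1 x)) fun x => by simp [v, hf]
  obtain ⟨K, hK, hKv⟩ := mem_cocompact.1 (hv.limit.eventually_lt_const one_lt_two)
  obtain ⟨C, hC⟩ := hK.exists_bound_of_continuousOn hv.contDiff.continuous.continuousOn
  refine ⟨max C 2, (by norm_num : (1 : ℝ) ≤ 2).trans (le_max_right _ _),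
    fun a α θ ha hα h x => ?_⟩
  have h1 : θ x ≤ v x := by
    have := h.mul_le_mul_add hv hκ.le hφ0 (p := 1) (q := 1) (d := 0) (by linarith)
      (fun y _ _ hlt => by
        rw [neg_zero, Real.rpow_zero, one_mul, one_mul]
        exact Real.rpow_le_one_of_one_le_of_nonpos (by linarith [hv1 y]) (by linarith)) x
    linarith
  refine h1.trans ?_
  by_cases hx : x ∈ K
  · exact ((le_abs_self _).trans (hC x hx)).trans (le_max_left _ _)
  · have : v x < 2 := hKv hx
    exact this.le.trans (le_max_right _ _)

/-- Raising the boundary value to max a δ moves each solution by at most δ, and then the estimate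
for boundary values away from zero applies. This covers a = 0. -/
lemma abs_sub_le_of_exponents {β δ M : ℝ} {θ τ θ' τ' : E3 → ℝ} (hκ : 0 < κ)
    (hφ0 : ∀ x, 0 ≤ φ x) (hα : 0 ≤ α) (hβ : 0 ≤ β) (ha : 0 ≤ a) (ha1 : a ≤ 1) (hδ : 0 < δ)
    (hδ1 : δ ≤ 1) (hM : 1 ≤ M)
    (hbound : ∀ a α θ, a ≤ 1 → 0 ≤ α → IsPoissonSol κ φ a α θ → ∀ x, θ x ≤ M)
    (h : IsPoissonSol κ φ a α θ) (h' : IsPoissonSol κ φ a β τ)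
    (hδθ : IsPoissonSol κ φ (max a δ) α θ') (hδτ : IsPoissonSol κ φ (max a δ) β τ') (x : E3) :
    |θ x - τ x| ≤ 2 * δ + M * ((M / δ) ^ |α - β| - 1) := by
  have hm1 : max a δ ≤ 1 := max_le ha1 hδ1
  have hma : max a δ - a ≤ δ := by
    rw [sub_le_iff_le_add]; exact max_le (by linarith) (by linarith)
  have h1 := h.mono hδθ hκ.le hφ0 hα (le_max_left _ _) x
  have h2 := h.le_add_sub hδθ hκ.le hφ0 hα (le_max_left _ _) x
  have h3 := h'.mono hδτ hκ.le hφ0 hβ (le_max_left _ _) x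
  have h4 := h'.le_add_sub hδτ hκ.le hφ0 hβ (le_max_left _ _) x
  have h5 := abs_le.1 (hδθ.abs_sub_le_of_le_boundary hδτ hκ.le hφ0 hα hβ hδ (le_max_right _ _)
    hm1 hM (hbound _ _ _ hm1 hα hδθ) (hbound _ _ _ hm1 hβ hδτ) x)
  rw [abs_le]
  constructor <;> linarith [h5.1, h5.2]

lemma tendsto_exponent_modulus {ι : Type*} {l : Filter ι} {d : ι → ℝ} (hd : Tendsto d l (𝓝 0))
    {M δ : ℝ} (hM : 1 ≤ M) (hδ : 0 < δ) :
    Tendsto (fun i => M * ((M / δ) ^ |d i| - 1)) l (𝓝 0) := by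
  have h1 : 0 < M / δ := by positivity
  have h2 : Tendsto (fun i => (M / δ) ^ |d i|) l (𝓝 ((M / δ) ^ |(0 : ℝ)|)) :=
    tendsto_const_nhds.rpow hd.abs (Or.inl h1.ne')
  have := (h2.sub_const 1).const_mul M
  simpa using this

/-- Existence for the exponent `1`, as a limit of solutions with smaller exponents. -/
lemma exists_isPoissonSol_one (hκ : 0 < κ) (hφ : ContDiff ℝ ∞ φ) (hφc : HasCompactSupport φ)
    (hφ0 : ∀ x, 0 ≤ φ x) (hne : ∃ x, φ x ≠ 0) (ha : 0 ≤ a) (ha1 : a ≤ 1) :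
    ∃ θ, IsPoissonSol κ φ a 1 θ := by
  obtain ⟨M, hM, hbound⟩ := exists_uniform_bound hκ hφ hφc hφ0
  have hM0 : 0 < M := by linarith
  set A : ℕ → ℝ := fun n => 1 - 1 / ((n : ℝ) + 1) with hAdef
  have hA0 : ∀ n, 0 ≤ A n := fun n => by
    have : 1 / ((n : ℝ) + 1) ≤ 1 := by
      rw [div_le_one (by positivity)]; linarith [n.cast_nonneg (α := ℝ)]
    simp only [hAdef]; linarith
  have hA1 : ∀ n, A n < 1 := fun n => by
    have : 0 < 1 / ((n : ℝ) + 1) := by positivity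
    simp only [hAdef]; linarith
  have hAlim : Tendsto A atTop (𝓝 1) := by
    have := (tendsto_one_div_add_atTop_nhds_zero_nat (𝕜 := ℝ)).const_sub 1
    rwa [sub_zero] at this
  have hex : ∀ b, 0 ≤ b → ∀ n, ∃ θ, IsPoissonSol κ φ b (A n) θ := fun b hb n =>
    exists_isPoissonSol_of_lt_one hκ hφ hφc hφ0 hne hb (hA0 n) (hA1 n)
  choose θ hθ using hex a ha
  have hpos : ∀ n x, 0 < θ n x := fun n => (hθ n).pos_of_nontrivial hκ.le hφ0 (Or.inr hne)
  have hθM : ∀ n x, θ n x ≤ M := fun n => hbound _ _ _ ha1 (hA0 n) (hθ n)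
  let F : ℕ → E3 →ᵇ ℝ := fun n => ofNormedAddCommGroup (θ n) (hθ n).contDiff.continuous M
    (fun x => by rw [Real.norm_of_nonneg (hpos n x).le]; exact hθM n x)
  have hF : CauchySeq F := by
    rw [Metric.cauchySeq_iff']
    intro ε hε
    -- δ is fixed before the exponents are brought together, because the modulus M((M/δ)^|α - β| -
    -- 1) degenerates as δ tends to 0.
    set δ := min 1 (ε / 4) with hδ
    have hδ0 : 0 < δ := by positivity
    have hδε : 2 * δ ≤ ε / 2 := by
      have := min_le_right 1 (ε / 4); linarith
    have hd : Tendsto (fun p : ℕ × ℕ => A p.1 - A p.2) atTop (𝓝 0) := by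
      rw [← prod_atTop_atTop_eq]
      simpa using (hAlim.comp tendsto_fst).sub (hAlim.comp tendsto_snd)
    have hev := (tendsto_exponent_modulus hd hM hδ0).eventually_lt_const
      (show (0 : ℝ) < ε / 4 by positivity)
    obtain ⟨⟨N₁, N₂⟩, hN⟩ := eventually_atTop.1 hev
    refine ⟨max N₁ N₂, fun n hn => ?_⟩
    have h1 := hN (n, max N₁ N₂) ⟨(le_max_left _ _).trans hn, le_max_right _ _⟩
    obtain ⟨θ', hθ'⟩ := hex (max a δ) (le_max_of_le_left ha) n
    obtain ⟨τ', hτ'⟩ := hex (max a δ) (le_max_of_le_left ha) (max N₁ N₂)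
    refine lt_of_le_of_lt ((BoundedContinuousFunction.dist_le (C := 3 * ε / 4)
      (by positivity)).2 fun x => ?_) (by linarith)
    rw [Real.dist_eq]
    have h2 := abs_sub_le_of_exponents hκ hφ0 (hA0 _) (hA0 _) ha ha1 hδ0 (min_le_left _ _) hM
      hbound (hθ n) (hθ (max N₁ N₂)) hθ' hτ' x
    simp only [F, coe_ofNormedAddCommGroup]
    linarith
  obtain ⟨θ₀, hθ₀⟩ := cauchySeq_tendsto_of_complete hF
  have hlim : ∀ x, Tendsto (fun n => θ n x) atTop (𝓝 (θ₀ x)) := fun x =>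
    ((continuous_eval_const (x := x)).tendsto θ₀).comp hθ₀
  set f : E3 → ℝ := fun y => κ * φ y with hf
  have hfC : Continuous f := continuous_const.mul hφ.continuous
  have hfc : HasCompactSupport f := HasCompactSupport.mul_left (f := fun _ => κ) hφc
  have hf0 : ∀ x, 0 ≤ f x := fun x => mul_nonneg hκ.le (hφ0 x)
  -- A positive lower bound for all θ n: as θ n ≤ M and A n < 1, the source is at least κφ/M. It
  -- keeps the limit positive and controls the negative powers.
  set b : E3 → ℝ := fun x => M⁻¹ * conv newtonKernel f x with hb
  have hbpos : ∀ x, 0 < b x := fun x => by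
    obtain ⟨y, hy⟩ := hne
    exact mul_pos (inv_pos.2 hM0) (conv_newtonKernel_pos hfC hfc hf0
      (mul_ne_zero hκ.ne' hy) x)
  have hbC : Continuous b := continuous_const.mul (continuous_iff_continuousAt.2 fun x =>
    (hasFDerivAt_conv_newtonKernel hfC hfc x).continuousAt)
  have hsrcC : ∀ n, Continuous fun y => κ * φ y * θ n y ^ (-A n) := fun n =>
    hfC.mul ((hθ n).contDiff.continuous.rpow_const fun y => Or.inl (hpos n y).ne')
  have hrep := fun n => (hθ n).eq_add_conv hφ hφc (hpos n)
  have hlower : ∀ n x, b x ≤ θ n x := fun n x => by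
    rw [hrep n x, hb]
    simp only
    rw [← conv_const_mul]
    refine le_add_of_nonneg_of_le ha (conv_mono locallyIntegrable_newtonKernel newtonKernel_nonneg
      (continuous_const.mul hfC) (HasCompactSupport.mul_left hfc) (hsrcC n)
      (hasCompactSupport_source hφc _) (fun y => ?_) x)
    rw [mul_comm]
    refine mul_le_mul_of_nonneg_left ?_ (hf0 y)
    calc M⁻¹ = M ^ (-1 : ℝ) := (Real.rpow_neg_one M).symm
      _ ≤ M ^ (-A n) := Real.rpow_le_rpow_of_exponent_le hM (by linarith [hA1 n])
      _ ≤ θ n y ^ (-A n) :=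
        Real.rpow_le_rpow_of_nonpos (hpos n y) (hθM n y) (by linarith [hA0 n])
  have hθ₀pos : ∀ x, 0 < θ₀ x := fun x =>
    (hbpos x).trans_le (ge_of_tendsto' (hlim x) fun n => hlower n x)
  refine ⟨θ₀, isPoissonSol_of_integral_equation hφ hφc θ₀.continuous hθ₀pos fun x => ?_⟩
  -- 1 + b⁻¹ dominates b^(-s) for every s in [0, 1], whether b is above or below 1.
  set D : E3 → ℝ := fun y => κ * φ y * (1 + (b y)⁻¹) with hD
  have hDC : Continuous D :=
    hfC.mul (continuous_const.add (hbC.inv₀ fun y => (hbpos y).ne'))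
  have hconv : Tendsto (fun n => conv newtonKernel (fun y => κ * φ y * θ n y ^ (-A n)) x) atTop
      (𝓝 (conv newtonKernel (fun y => κ * φ y * θ₀ y ^ (-1 : ℝ)) x)) := by
    refine tendsto_integral_of_dominated_convergence
      (fun t => newtonKernel t * D (x - t)) (fun n =>
        (integrable_conv locallyIntegrable_newtonKernel (hsrcC n)
          (hasCompactSupport_source hφc _) x).aestronglyMeasurable)
      (integrable_conv locallyIntegrable_newtonKernel hDC (hasCompactSupport_source hφc _) x)
      (fun n => Eventually.of_forall fun t => ?_) (Eventually.of_forall fun t => ?_)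
    · set y := x - t
      rw [norm_mul, Real.norm_of_nonneg (newtonKernel_nonneg t), Real.norm_of_nonneg
        (mul_nonneg (hf0 y) (Real.rpow_nonneg (hpos n y).le _))]
      refine mul_le_mul_of_nonneg_left (mul_le_mul_of_nonneg_left ?_ (hf0 y))
        (newtonKernel_nonneg t)
      have hbi : 0 < (b y)⁻¹ := inv_pos.2 (hbpos y)
      refine (Real.rpow_le_rpow_of_nonpos (hbpos y) (hlower n y) (by linarith [hA0 n])).trans ?_
      rcases le_total 1 (b y) with h1 | h1
      · have := Real.rpow_le_one_of_one_le_of_nonpos h1 (by linarith [hA0 n] : -A n ≤ 0)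
        linarith
      · have := Real.rpow_le_rpow_of_exponent_ge (hbpos y) h1
          (by linarith [hA1 n] : (-1 : ℝ) ≤ -A n)
        rw [Real.rpow_neg_one] at this
        linarith
    · exact (((hlim (x - t)).rpow hAlim.neg (Or.inl (hθ₀pos _).ne')).const_mul _).const_mul _
  refine tendsto_nhds_unique (hlim x) ?_
  refine (hconv.const_add a).congr fun n => (hrep n x).symm

theorem exists_isPoissonSol (hκ : 0 < κ) (hφ : ContDiff ℝ ∞ φ) (hφc : HasCompactSupport φ)
    (hφ0 : ∀ x, 0 ≤ φ x) (ha : a ∈ Icc (0 : ℝ) 1) (hα : α ∈ Icc (0 : ℝ) 1) :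
    ∃ θ, IsPoissonSol κ φ a α θ := by
  by_cases hne : ∃ x, φ x ≠ 0
  · rcases hα.2.lt_or_eq with h1 | rfl
    · exact exists_isPoissonSol_of_lt_one hκ hφ hφc hφ0 hne ha.1 hα.1 h1
    · exact exists_isPoissonSol_one hκ hφ hφc hφ0 hne ha.1 ha.2
  · push Not at hne
    exact ⟨_, isPoissonSol_const κ ha.1 hne⟩

end Existence

/-! ### Dependence on the parameters -/

section Dependence

variable {κ : ℝ} {φ : E3 → ℝ}

/-- The solutions form a smooth family, jointly with the boundary value and the exponent. -/
theorem jointC_of_isPoissonSol (hκ : 0 < κ) (hφ : ContDiff ℝ ∞ φ) (hφc : HasCompactSupport φ)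
    (hφ0 : ∀ x, 0 ≤ φ x) {Θ : ℝ → ℝ → E3 → ℝ}
    (hΘ : ∀ a ∈ Icc (0 : ℝ) 1, ∀ α ∈ Icc (0 : ℝ) 1, IsPoissonSol κ φ a α (Θ a α)) (k : ℕ) :
    JointC k fun p : Icc (0 : ℝ) 1 × Icc (0 : ℝ) 1 => Θ p.1 p.2 := by
  have hS : ∀ p : Icc (0 : ℝ) 1 × Icc (0 : ℝ) 1, IsPoissonSol κ φ p.1 p.2 (Θ p.1 p.2) :=
    fun p => hΘ _ p.1.2 _ p.2.2
  have hc1 : Continuous fun p : Icc (0 : ℝ) 1 × Icc (0 : ℝ) 1 => (p.1 : ℝ) :=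
    continuous_subtype_val.comp continuous_fst
  have hc2 : Continuous fun p : Icc (0 : ℝ) 1 × Icc (0 : ℝ) 1 => (p.2 : ℝ) :=
    continuous_subtype_val.comp continuous_snd
  by_cases hne : ∃ x, φ x ≠ 0
  swap
  · push Not at hne
    have e : (fun p : Icc (0 : ℝ) 1 × Icc (0 : ℝ) 1 => Θ p.1 p.2) = fun p _ => (p.1 : ℝ) :=
      funext fun p => (hS p).unique (isPoissonSol_const κ p.1.2.1 hne) hκ.le hφ0 p.2.2.1
    rw [e]
    exact JointC.parameter hc1
  have hpos : ∀ p : Icc (0 : ℝ) 1 × Icc (0 : ℝ) 1, ∀ x, 0 < Θ p.1 p.2 x := fun p =>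
    (hS p).pos_of_nontrivial hκ.le hφ0 (Or.inr hne)
  refine jointC_of_integral_equation hc1 hc2 hφ hφc ?_ hpos
    (fun p => (hS p).eq_add_conv hφ hφc (hpos p)) k
  obtain ⟨M, hM, hbound⟩ := exists_uniform_bound hκ hφ hφc hφ0
  rw [continuous_iff_continuousAt]
  rintro ⟨p₀, x₀⟩
  rw [ContinuousAt, Metric.tendsto_nhds]
  intro ε hε
  -- The increment is split into a change of a (Lipschitz), of α (at most 2δ plus the modulus) and
  -- of x at the fixed parameters p₀, with ε/4 allowed for each of the four terms.
  set δ := min 1 (ε / 8) with hδ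
  have hδ0 : 0 < δ := by positivity
  have hδε : 2 * δ ≤ ε / 4 := by
    have := min_le_right 1 (ε / 8); linarith
  have hd : Tendsto (fun q : (Icc (0 : ℝ) 1 × Icc (0 : ℝ) 1) × E3 => (q.1.2 : ℝ) - p₀.2)
      (𝓝 (p₀, x₀)) (𝓝 0) := by
    have := (((hc2.comp continuous_fst).sub (continuous_const (y := (p₀.2 : ℝ)))).tendsto
      (p₀, x₀))
    simpa using! this
  have hd' : Tendsto (fun q : (Icc (0 : ℝ) 1 × Icc (0 : ℝ) 1) × E3 => |(q.1.1 : ℝ) - p₀.1|)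
      (𝓝 (p₀, x₀)) (𝓝 0) := by
    have := (((hc1.comp continuous_fst).sub (continuous_const (y := (p₀.1 : ℝ)))).abs.tendsto
      (p₀, x₀))
    simpa using! this
  have hd3 : Tendsto (fun q : (Icc (0 : ℝ) 1 × Icc (0 : ℝ) 1) × E3 => Θ p₀.1 p₀.2 q.2)
      (𝓝 (p₀, x₀)) (𝓝 (Θ p₀.1 p₀.2 x₀)) :=
    ((hS p₀).contDiff.continuous.comp continuous_snd).tendsto (p₀, x₀)
  filter_upwards [(tendsto_exponent_modulus hd hM hδ0).eventually_lt_const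
    (show (0 : ℝ) < ε / 4 by positivity), hd'.eventually_lt_const
    (show (0 : ℝ) < ε / 4 by positivity), Metric.tendsto_nhds.1 hd3 (ε / 4) (by positivity)]
    with q h1 h2 h3
  obtain ⟨⟨a, α⟩, x⟩ := q
  simp only at h1 h2 h3 ⊢
  have hA : |Θ a α x - Θ p₀.1 α x| ≤ |(a : ℝ) - p₀.1| := by
    have s1 := hΘ a a.2 α α.2
    have s2 := hΘ p₀.1 p₀.1.2 α α.2
    rcases le_total (a : ℝ) p₀.1 with hle | hle
    · have e1 := s1.mono s2 hκ.le hφ0 α.2.1 hle x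
      have e2 := s1.le_add_sub s2 hκ.le hφ0 α.2.1 hle x
      rw [abs_of_nonpos (by linarith), abs_of_nonpos (by linarith)]
      linarith
    · have e1 := s2.mono s1 hκ.le hφ0 α.2.1 hle x
      have e2 := s2.le_add_sub s1 hκ.le hφ0 α.2.1 hle x
      rw [abs_of_nonneg (by linarith), abs_of_nonneg (by linarith)]
      linarith
  have hm : max (p₀.1 : ℝ) δ ∈ Icc (0 : ℝ) 1 :=
    ⟨le_max_of_le_left p₀.1.2.1, max_le p₀.1.2.2 (min_le_left _ _)⟩
  have hB := abs_sub_le_of_exponents hκ hφ0 α.2.1 p₀.2.2.1 p₀.1.2.1 p₀.1.2.2 hδ0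
    (min_le_left _ _) hM hbound (hΘ p₀.1 p₀.1.2 α α.2) (hS p₀) (hΘ _ hm α α.2)
    (hΘ _ hm p₀.2 p₀.2.2) x
  rw [Real.dist_eq] at h3 ⊢
  have t1 := abs_sub_le (Θ a α x) (Θ p₀.1 α x) (Θ p₀.1 p₀.2 x₀)
  have t2 := abs_sub_le (Θ p₀.1 α x) (Θ p₀.1 p₀.2 x) (Θ p₀.1 p₀.2 x₀)
  linarith

end Dependence

/-! ### The main theorem -/

theorem proposition2p2 (G c : ℝ) (hG : 0 < G) (hc : 0 < c)
    (φ : E3 → ℝ) (hφ_smooth : ContDiff ℝ ∞ φ) (hφ_supp : HasCompactSupport φ)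
    (hφ_nonneg : ∀ x, 0 ≤ φ x) :
    -- existence and uniqueness
    (∀ a ∈ Icc (0 : ℝ) 1, ∀ α ∈ Icc (0 : ℝ) 1,
      ∃! θ : E3 → ℝ, IsGenPoissonSolution G c φ a α θ) ∧
    -- properties of the family of solutions
    ∀ Θ : ℝ → ℝ → E3 → ℝ,
      (∀ a ∈ Icc (0 : ℝ) 1, ∀ α ∈ Icc (0 : ℝ) 1, IsGenPoissonSolution G c φ a α (Θ a α)) →
      -- the solutions are smooth
      (∀ a ∈ Icc (0 : ℝ) 1, ∀ α ∈ Icc (0 : ℝ) 1, ContDiff ℝ ∞ (Θ a α)) ∧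
      -- they are positive unless the data are trivial
      (∀ a ∈ Icc (0 : ℝ) 1, ∀ α ∈ Icc (0 : ℝ) 1, (0 < a ∨ ∃ x, φ x ≠ 0) →
        ∀ x, 0 < Θ a α x) ∧
      -- continuous dependence on the pair of parameters
      (∀ (a α : ℝ) (as αs : ℕ → ℝ), a ∈ Icc (0 : ℝ) 1 → α ∈ Icc (0 : ℝ) 1 →
        (∀ n, as n ∈ Icc (0 : ℝ) 1) → (∀ n, αs n ∈ Icc (0 : ℝ) 1) →
        Tendsto as atTop (𝓝 a) → Tendsto αs atTop (𝓝 α) →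
        TendstoSmoothOnCompacts (fun n => Θ (as n) (αs n)) (Θ a α)) ∧
      -- monotonicity in the boundary value
      (∀ a ∈ Icc (0 : ℝ) 1, ∀ b ∈ Icc (0 : ℝ) 1, ∀ α ∈ Icc (0 : ℝ) 1, a ≤ b →
        ∀ x, 0 ≤ Θ b α x - Θ a α x ∧ Θ b α x - Θ a α x ≤ b - a) ∧
      -- monotonicity in the exponent
      (∀ a ∈ Icc (0 : ℝ) 1, ∀ α ∈ Icc (0 : ℝ) 1, ∀ β ∈ Icc (0 : ℝ) 1, α ≤ β →
        ∀ x, a ^ β * Θ a β x ≤ a ^ α * Θ a α x) := by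
  have hκ : 0 < 4 * Real.pi * (G / (2 * c ^ 2)) := by positivity
  refine ⟨fun a ha α hα => ?_, fun Θ hΘ => ?_⟩
  · obtain ⟨θ, hθ⟩ := exists_isPoissonSol hκ hφ_smooth hφ_supp hφ_nonneg ha hα
    exact ⟨θ, hθ.isGenPoissonSolution, fun τ hτ =>
      (hτ.isPoissonSol hG hc hφ_nonneg).unique hθ hκ.le hφ_nonneg hα.1⟩
  have hS : ∀ a ∈ Icc (0 : ℝ) 1, ∀ α ∈ Icc (0 : ℝ) 1,
      IsPoissonSol (4 * Real.pi * (G / (2 * c ^ 2))) φ a α (Θ a α) := fun a ha α hα =>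
    (hΘ a ha α hα).isPoissonSol hG hc hφ_nonneg
  have hJ := jointC_of_isPoissonSol hκ hφ_smooth hφ_supp hφ_nonneg hS
  refine ⟨fun a ha α hα => ?_, fun a ha α hα hne => ?_, fun a α as αs ha hα has hαs hal hαl => ?_,
    fun a ha b hb α hα hab x => ⟨?_, ?_⟩, fun a ha α hα β hβ hαβ x => ?_⟩
  · exact contDiff_infty.2 fun k => (hJ k).contDiff (⟨a, ha⟩, ⟨α, hα⟩)
  · exact (hS a ha α hα).pos_of_nontrivial hκ.le hφ_nonneg hne
  · refine tendstoSmoothOnCompacts_of_jointC hJ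
      (p := fun n => (⟨as n, has n⟩, ⟨αs n, hαs n⟩)) (q := (⟨a, ha⟩, ⟨α, hα⟩)) ?_
    exact (tendsto_subtype_rng.2 hal).prodMk_nhds (tendsto_subtype_rng.2 hαl)
  · exact sub_nonneg.2 ((hS a ha α hα).mono (hS b hb α hα) hκ.le hφ_nonneg hα.1 hab x)
  · have := (hS a ha α hα).le_add_sub (hS b hb α hα) hκ.le hφ_nonneg hα.1 hab x
    linarith
  -- For a = 0 the comparison is unavailable: 0^β = 0 makes the left side vanish unless β = 0, and
  -- then α = 0 too.
  · rcases ha.1.eq_or_lt with rfl | ha0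
    · rcases hβ.1.eq_or_lt with rfl | hβ0
      · rw [le_antisymm hαβ hα.1]
      · rw [Real.zero_rpow hβ0.ne', zero_mul]
        exact mul_nonneg (Real.rpow_nonneg le_rfl _) ((hS 0 ha α hα).nonneg x)
    · exact (hS a ha α hα).boundary_rpow_mul_le (hS a ha β hβ) hκ.le hφ_nonneg hα.1 hαβ ha0 ha.2 x
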